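/- **Setting.** Let $\mathbb S^2\subset\mathbb R^3$ be the unit sphere with surface measure $dm$, and for $\alpha\in\mathbb R$ let $\mathcal U f(m)=\alpha\int_{\mathbb S^2}|m\times m'|^2f(m')\,dm'$. A positive $h\in L^2(\mathbb S^2)$ is a *critical point* if $\ln h+\mathcal Uh$ is constant a.e.; a critical point $h$ is *stable* if $\int_{\mathbb S^2}\big(\tfrac{\phi}{h}+\mathcal U\phi\big)\phi\,dm\ge 0$ for all $\phi\in L^2(\mathbb S^2)$ with $\int_{\mathbb S^2}\phi\,dm=0$. For $\eta\in\mathbb R$ and $n_0\in\mathbb S^2$ put $$h_{\eta,n_0}(m)=\frac{e^{\eta(m\cdot n_0)^2}}{\int_{\mathbb S^2}e^{\eta(m'\cdot n_0)^2}dm'},\qquad \langle F\rangle=\int_{\mathbb S^2}F\,h_{\eta,n_0}\,dm .$$ Suppose that $\eta\neq0$ and that $h_{\eta,n_0}$ is a critical point. Let $\theta\in[0,\pi]$ be the angle between $m$ and $n_0$, write $\mathcal Uh_{\eta,n_0}=u_0(\theta)$, and let $g_0\in C^2(0,\pi)\cap C^1[0,\pi]$ with $g_0(0)=g_0(\pi)=0$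 be a solution of $$\frac1{\sin\theta}\frac{d}{d\theta}\Big(\sin\theta\frac{dg_0}{d\theta}\Big)-\frac{g_0}{\sin^2\theta}-\frac{du_0}{d\theta}\frac{dg_0}{d\theta}=-\frac{du_0}{d\theta}\quad\text{on }(0,\pi).$$ With $P_k$ the $k$-th Legendre polynomial set $$S_2=\langle P_2(m\cdot n_0)\rangle,\quad S_4=\langle P_4(m\cdot n_0)\rangle,\quad \lambda=\frac{\langle 3(m\cdot n_0)^2-1\rangle}{\langle g_0\,\frac{du_0}{d\theta}\rangle},$$ $$\alpha_1=-\tfrac{S_4}{2},\quad \alpha_2=-\tfrac12\big(1+\tfrac1\lambda\big)S_2,\quad \alpha_3=-\tfrac12\big(1-\tfrac1\lambda\big)S_2,$$ $$\alpha_4=\tfrac4{15}-\tfrac5{21}S_2-\tfrac1{35}S_4,\quad \alpha_5=\tfrac17S_4+\tfrac67S_2,\quad \alpha_6=\tfrac17S_4-\tfrac17S_2,$$ and $\gamma_1=\alpha_3-\alpha_2$, $\gamma_2=\alpha_6-\alpha_5$. **Theorem.** (a) $\gamma_1>0$. (b) For every real symmetric $3\times3$ matrix $D$ and every $n\in\mathbb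 S^2$, $$\Big(\alpha_1+\frac{\gamma_2^2}{\gamma_1}\Big)|D:nn|^2+\alpha_4\,D:D+\Big(\alpha_5+\alpha_6-\frac{\gamma_2^2}{\gamma_1}\Big)|D\cdot n|^2\ \ge\ 0,$$ provided that $h_{\eta,n_0}$ is stable, or $\eta>0$, or $\operatorname{tr}D=0$. (c) Consequently the dissipation rate in the Ericksen–Leslie energy law is nonnegative: let $0<\gamma<1$, $k\in\mathbb R$, $\Omega\subseteq\mathbb R^3$ open, $v\in C^1(\Omega;\mathbb R^3)$ with $\operatorname{div}v=0$, and $n\in C^2(\Omega;\mathbb R^3)$ with $|n|=1$; put $D=\frac12(\nabla v+(\nabla v)^T)$ and $h=k\Delta n$. Then $$\int_\Omega\Big(\frac{\gamma}{1-\gamma}|\nabla v|^2+\Big(\alpha_1+\frac{\gamma_2^2}{\gamma_1}\Big)|D:nn|^2+\alpha_4D:D+\Big(\alpha_5+\alpha_6-\frac{\gamma_2^2}{\gamma_1}\Big)|D\cdot n|^2+\frac1{\gamma_1}|n\times h|^2\Big)dx\ \ge\ 0$$ whenever the integrand is integrable on $\Omega$. -/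

import Mathlib

open MeasureTheory Set Filter Topology
open scoped Matrix

noncomputable section

namespace DoiOnsager

/-- Three-dimensional Euclidean space. -/
abbrev E3 : Type := EuclideanSpace ℝ (Fin 3)

/-- The unit sphere of three-dimensional Euclidean space. -/
abbrev Sphere2 : Type := Metric.sphere (0 : E3) 1

/-- The surface measure on the unit sphere (total mass `4π`). -/
def surf : Measure Sphere2 := (volume : Measure E3).toSphere

/-- The inner product `m · n` of two unit vectors. -/
def dotS (m n : Sphere2) : ℝ := inner ℝ (m : E3) (n : E3)

/-- The squared length `|m × m'|²` of the cross product. -/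
def crossSq (m m' : Sphere2) : ℝ :=
  ((m : E3).ofLp ⨯₃ (m' : E3).ofLp) ⬝ᵥ ((m : E3).ofLp ⨯₃ (m' : E3).ofLp)

/-- The Maier-Saupe mean-field potential `𝒰 f (m) = α ∫ |m × m'|² f(m') dm'`. -/
def potential (α : ℝ) (f : Sphere2 → ℝ) (m : Sphere2) : ℝ :=
  α * ∫ m', crossSq m m' * f m' ∂surf

/-- Critical points of the energy `A[f] = ∫ f ln f + ½ f 𝒰 f`:
positive square-integrable densities with `ln h + 𝒰 h` constant. -/
def IsCriticalPoint (α : ℝ) (h : Sphere2 → ℝ) : Prop :=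
  MemLp h 2 surf ∧ (∀ᵐ m ∂surf, 0 < h m) ∧
    ∃ c : ℝ, ∀ᵐ m ∂surf, Real.log (h m) + potential α h m = c

/-- Stability: the second variation `⟨φ/h + 𝒰 φ, φ⟩` is nonnegative on square-integrable
functions of mean zero. -/
def IsStable (α : ℝ) (h : Sphere2 → ℝ) : Prop :=
  ∀ φ : Sphere2 → ℝ, MemLp φ 2 surf → ∫ m, φ m ∂surf = 0 →
    0 ≤ ∫ m, (φ m / h m + potential α φ m) * φ m ∂surf

/-- The axially symmetric density
`h_{η,n}(m) = exp(η (m·n)²) / ∫ exp(η (m'·n)²) dm'`. -/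
def equilibrium (η : ℝ) (n : Sphere2) (m : Sphere2) : ℝ :=
  Real.exp (η * dotS m n ^ 2) / ∫ m', Real.exp (η * dotS m' n ^ 2) ∂surf

/-- The average `⟨F⟩` of a function on the sphere under `h_{η,n}`. -/
def avg (η : ℝ) (n : Sphere2) (F : Sphere2 → ℝ) : ℝ := ∫ m, F m * equilibrium η n m ∂surf

/-- The `k`-th Legendre polynomial (Rodrigues' formula). -/
def legendreP (k : ℕ) : Polynomial ℝ :=
  Polynomial.C (1 / (2 ^ k * (k.factorial : ℝ))) *
    Polynomial.derivative^[k] ((Polynomial.X ^ 2 - 1) ^ k)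

/-- The order parameter `S_k = ⟨P_k(m·n)⟩` under `h_{η,n}`. -/
def orderParam (k : ℕ) (η : ℝ) (n : Sphere2) : ℝ :=
  avg η n fun m => (legendreP k).eval (dotS m n)

/-- The polar angle `θ ∈ [0, π]` between `m` and `n`. -/
def polarAngle (n m : Sphere2) : ℝ := InnerProductGeometry.angle (m : E3) (n : E3)

/-- `u₀` is `𝒰 h_{η,n}` written as a function of the polar angle `θ` between `m` and `n`. -/
def IsPotentialProfile (α η : ℝ) (n : Sphere2) (u₀ : ℝ → ℝ) : Prop :=
  ∀ m : Sphere2, potential α (equilibrium η n) m = u₀ (polarAngle n m)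

/-- `g₀` is a regular solution on `(0, π)` of
`(1/sin θ) (sin θ g₀')' - g₀ / sin² θ - u₀' g₀' = - u₀'`.
Being `C¹` up to the end points and vanishing there says that
`(Θ · e_φ) g₀(θ)` is a `C¹` function on the whole sphere, poles included; this is the side condition
which singles out the solution. -/
structure IsKernelProfile (u₀ g₀ : ℝ → ℝ) : Prop where
  contDiffOn_Icc : ContDiffOn ℝ 1 g₀ (Icc 0 Real.pi)
  contDiffOn_Ioo : ContDiffOn ℝ 2 g₀ (Ioo 0 Real.pi)
  north : g₀ 0 = 0
  south : g₀ Real.pi = 0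
  ode : ∀ θ ∈ Ioo 0 Real.pi,
    1 / Real.sin θ * deriv (fun s => Real.sin s * deriv g₀ s) θ
      - g₀ θ / Real.sin θ ^ 2 - deriv u₀ θ * deriv g₀ θ = - deriv u₀ θ

/-- `λ = ⟨3 (m·n)² - 1⟩ / ⟨g₀ du₀/dθ⟩`, averages under `h_{η,n}`. -/
def tumbling (η : ℝ) (n : Sphere2) (u₀ g₀ : ℝ → ℝ) : ℝ :=
  avg η n (fun m => 3 * dotS m n ^ 2 - 1) /
    avg η n (fun m => g₀ (polarAngle n m) * deriv u₀ (polarAngle n m))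

/-- A set of six Leslie coefficients. -/
structure LeslieCoeffs where
  α₁ : ℝ
  α₂ : ℝ
  α₃ : ℝ
  α₄ : ℝ
  α₅ : ℝ
  α₆ : ℝ

namespace LeslieCoeffs

/-- `γ₁ = α₃ - α₂`. -/
def γ₁ (c : LeslieCoeffs) : ℝ := c.α₃ - c.α₂

/-- `γ₂ = α₆ - α₅`. -/
def γ₂ (c : LeslieCoeffs) : ℝ := c.α₆ - c.α₅

end LeslieCoeffs

/-- The Leslie coefficients in terms of `S₂`, `S₄` and `λ`. -/
def leslieOf (s₂ s₄ lam : ℝ) : LeslieCoeffs where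
  α₁ := - s₄ / 2
  α₂ := - (1 / 2) * (1 + 1 / lam) * s₂
  α₃ := - (1 / 2) * (1 - 1 / lam) * s₂
  α₄ := 4 / 15 - 5 / 21 * s₂ - 1 / 35 * s₄
  α₅ := 1 / 7 * s₄ + 6 / 7 * s₂
  α₆ := 1 / 7 * s₄ - 1 / 7 * s₂

/-- The Leslie coefficients derived from the Doi-Onsager theory at `h_{η,n}`. -/
def leslie (η : ℝ) (n : Sphere2) (u₀ g₀ : ℝ → ℝ) : LeslieCoeffs :=
  leslieOf (orderParam 2 η n) (orderParam 4 η n) (tumbling η n u₀ g₀)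

/-- `A : B = ∑ᵢⱼ Aᵢⱼ Bᵢⱼ`. -/
def frob (A B : Matrix (Fin 3) (Fin 3) ℝ) : ℝ := ∑ i, ∑ j, A i j * B i j

/-- The quadratic form
`(α₁ + γ₂²/γ₁) |D:nn|² + α₄ D:D + (α₅ + α₆ - γ₂²/γ₁) |D·n|²`. -/
def leslieForm (c : LeslieCoeffs) (D : Matrix (Fin 3) (Fin 3) ℝ) (n : Fin 3 → ℝ) : ℝ :=
  (c.α₁ + c.γ₂ ^ 2 / c.γ₁) * |frob D (Matrix.vecMulVec n n)| ^ 2 + c.α₄ * frob D D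
    + (c.α₅ + c.α₆ - c.γ₂ ^ 2 / c.γ₁) * ((D *ᵥ n) ⬝ᵥ (D *ᵥ n))

/-- The matrix `(∇v)ᵢⱼ = ∂ᵢ vⱼ` of partial derivatives of a vector field. -/
def grad (v : E3 → E3) (x : E3) : Matrix (Fin 3) (Fin 3) ℝ :=
  Matrix.of fun i j => fderiv ℝ v x (EuclideanSpace.single i 1) j

/-- The symmetric part `D = ½ (∇v + (∇v)ᵀ)` of the velocity gradient. -/
def strain (v : E3 → E3) (x : E3) : Matrix (Fin 3) (Fin 3) ℝ :=
  (1 / 2 : ℝ) • (grad v x + (grad v x)ᵀ)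

/-- The integrand on the right of the Ericksen-Leslie energy law,
`γ/(1-γ) |∇v|² + (quadratic form in D) + (1/γ₁) |n × h|²`, with molecular field `h = k Δn`. -/
def dissipationDensity (c : LeslieCoeffs) (γ k : ℝ) (v n : E3 → E3) (x : E3) : ℝ :=
  γ / (1 - γ) * frob (grad v x) (grad v x) + leslieForm c (strain v x) (n x).ofLp
    + 1 / c.γ₁ * (((n x).ofLp ⨯₃ (k • Laplacian.laplacian n x).ofLp) ⬝ᵥ
        ((n x).ofLp ⨯₃ (k • Laplacian.laplacian n x).ofLp))

end DoiOnsager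

end

open DoiOnsager

namespace DoiOnsager

/-! Write x = m·n₀ and M_k = ⟨x^k⟩ (`meanPow`). Integration by parts gives 2η(M₂ − M₄) = 3M₂ − 1,
and criticality means η = α(3M₂ − 1)/2. Hence α(M₂ − M₄) = 1, u₀' = 2η sin θ cos θ, and S₂ = (3M₂ −
1)/2 is nonzero with the sign of η.

The definition of λ gives γ₁ = S₂/λ = ½⟨g₀u₀'⟩. The equation for g₀ has a weak form B(g₀, w) = ⟨w
u₀'⟩ with the positive form B(g, w) = ⟨g'w' + gw/sin²θ⟩. Cauchy-Schwarz against w = sin θ cos θ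
(`IsKernelProfile.sq_le`) yields (3M₂ − 1)² ≤ (1 − 3M₂ + 4M₄)·2γ₁. This proves γ₁ > 0 and, since γ₂
= −S₂, also γ₂²/γ₁ ≤ (1 − 3M₂ + 4M₄)/2.

Split D along n into a = D:nn, the mixed part of squared length |D·n|² − a², and the block
orthogonal to n. The quadratic form is then diagonal, with coefficients α₁ + α₄ + α₅ + α₆, 2α₄ + α₅
+ α₆ − γ₂²/γ₁ and α₄ (`leslieForm_nonneg`). The last is nonnegative because M₄ < M₂ < 1, and the
second is at least M₂ − M₄. The first equals (−1 + 26M₂ − 17M₄)/16, which is nonnegative if η > 0 or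
if h is stable against the biaxial perturbation (m₀² − m₁²)h (`meanPow_ineq`). If tr D = 0, the
orthogonal block has trace −a and contributes an extra α₄a²/2, which makes the first coefficient
positive in all cases. Incompressible flow falls under this last case. -/

/-! ### Spherical coordinates and the surface measure. -/

/-- The point `x b₀ + y b₁ + z b₂`, as a function of `(z, (x, y))`. -/
noncomputable def cylPoint (b : OrthonormalBasis (Fin 3) ℝ E3) (p : ℝ × (ℝ × ℝ)) : E3 :=
  p.2.1 • b 0 + p.2.2 • b 1 + p.1 • b 2

lemma measurePreserving_cylPoint (b : OrthonormalBasis (Fin 3) ℝ E3) :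
    MeasurePreserving (cylPoint b) := by
  have h1 := b.measurePreserving_repr_symm
  have h2 := PiLp.volume_preserving_toLp (Fin 3)
  have h3 := (volume_preserving_piFinSuccAbove (fun _ : Fin 3 => ℝ) 2).symm
  have h4 := (volume_preserving_piFinTwo (fun _ : Fin 2 => ℝ)).symm
  have h5 : MeasurePreserving (fun p : ℝ × (ℝ × ℝ) =>
      (p.1, (MeasurableEquiv.piFinTwo (fun _ : Fin 2 => ℝ)).symm p.2)) volume volume :=
    (MeasurePreserving.id volume).prod h4
  have h := h1.comp (h2.comp (h3.comp h5))
  have he : cylPoint b = b.repr.symm ∘ WithLp.toLp 2 ∘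
      (MeasurableEquiv.piFinSuccAbove (fun _ : Fin 3 => ℝ) 2).symm ∘
        fun p : ℝ × (ℝ × ℝ) => (p.1, (MeasurableEquiv.piFinTwo (fun _ : Fin 2 => ℝ)).symm p.2) := by
    funext p
    simp only [Function.comp_apply]
    rw [← b.sum_repr_symm, Fin.sum_univ_three]
    rfl
  rw [he]
  exact h

/-- Polar coordinates are used twice: in the plane of b₀ and b₁, and then in the half-plane of (z,
r). The Jacobians r = ρ sin θ and ρ multiply to ρ² sin θ. -/
lemma lintegral_spherical (b : OrthonormalBasis (Fin 3) ℝ E3) {F : E3 → ENNReal}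
    (hF : Measurable F) :
    ∫⁻ y, F y = ∫⁻ φ in Ioo (-Real.pi) Real.pi, ∫⁻ ρ in Ioi (0 : ℝ), ∫⁻ θ in Ioo 0 Real.pi,
      ENNReal.ofReal (ρ ^ 2 * Real.sin θ) *
        F (cylPoint b (ρ * Real.cos θ,
          (ρ * Real.sin θ * Real.cos φ, ρ * Real.sin θ * Real.sin φ))) := by
  have hc : Measurable (cylPoint b) := (measurePreserving_cylPoint b).measurable
  calc ∫⁻ y, F y = ∫⁻ p, F (cylPoint b p) := ((measurePreserving_cylPoint b).lintegral_comp hF).symm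
    _ = ∫⁻ z : ℝ, ∫⁻ w : ℝ × ℝ, F (cylPoint b (z, w)) := by
      rw [Measure.volume_eq_prod, lintegral_prod _ (by fun_prop)]
    _ = ∫⁻ z : ℝ, ∫⁻ φ in Ioo (-Real.pi) Real.pi, ∫⁻ r in Ioi (0 : ℝ),
          ENNReal.ofReal r * F (cylPoint b (z, (r * Real.cos φ, r * Real.sin φ))) := by
      congr 1 with z
      rw [← lintegral_comp_polarCoord_symm, polarCoord_target, Measure.volume_eq_prod,
        ← Measure.prod_restrict, lintegral_prod_symm _ (by simp; fun_prop)]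
      simp
    _ = ∫⁻ φ in Ioo (-Real.pi) Real.pi, ∫⁻ z : ℝ, ∫⁻ r in Ioi (0 : ℝ),
          ENNReal.ofReal r * F (cylPoint b (z, (r * Real.cos φ, r * Real.sin φ))) := by
      rw [lintegral_lintegral_swap]
      have : Measurable fun q : (ℝ × ℝ) × ℝ =>
          ENNReal.ofReal q.2 *
            F (cylPoint b (q.1.1, (q.2 * Real.cos q.1.2, q.2 * Real.sin q.1.2))) := by
        fun_prop
      exact this.lintegral_prod_right'.aemeasurable
    -- The indicator of r > 0 extends the half-plane to a full plane, where `polarCoord` applies; it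
    -- later cuts the angle down to (0, π).
    _ = ∫⁻ φ in Ioo (-Real.pi) Real.pi, ∫⁻ ρ in Ioi (0 : ℝ), ∫⁻ θ in Ioo (-Real.pi) Real.pi,
          ENNReal.ofReal ρ * (Ioi (0 : ℝ)).indicator (fun r => ENNReal.ofReal r *
            F (cylPoint b (ρ * Real.cos θ, (r * Real.cos φ, r * Real.sin φ))))
            (ρ * Real.sin θ) := by
      congr 1 with φ
      have hm : Measurable fun p : ℝ × ℝ => (Ioi (0 : ℝ)).indicator (fun r =>
          ENNReal.ofReal r * F (cylPoint b (p.1, (r * Real.cos φ, r * Real.sin φ)))) p.2 := by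
        have : Measurable ((Prod.snd ⁻¹' Ioi (0 : ℝ)).indicator (fun p : ℝ × ℝ =>
          ENNReal.ofReal p.2 * F (cylPoint b (p.1, (p.2 * Real.cos φ, p.2 * Real.sin φ))))) :=
          Measurable.indicator (by fun_prop) (measurable_snd measurableSet_Ioi)
        exact this
      have h1 : ∀ z : ℝ, ∫⁻ r in Ioi (0 : ℝ),
          ENNReal.ofReal r * F (cylPoint b (z, (r * Real.cos φ, r * Real.sin φ))) =
          ∫⁻ r, (Ioi (0 : ℝ)).indicator (fun r =>
          ENNReal.ofReal r * F (cylPoint b (z, (r * Real.cos φ, r * Real.sin φ)))) r :=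
          fun z => (lintegral_indicator measurableSet_Ioi _).symm
      simp_rw [h1]
      rw [← lintegral_prod (f := fun p : ℝ × ℝ => (Ioi (0 : ℝ)).indicator (fun r =>
          ENNReal.ofReal r * F (cylPoint b (p.1, (r * Real.cos φ, r * Real.sin φ)))) p.2)
          hm.aemeasurable, ← Measure.volume_eq_prod, ← lintegral_comp_polarCoord_symm,
          polarCoord_target, Measure.volume_eq_prod, ← Measure.prod_restrict, lintegral_prod]
      · simp
      · have : Measurable fun p : ℝ × ℝ => polarCoord.symm p := by simp; fun_prop
        exact (Measurable.mul (by fun_prop) (hm.comp this)).aemeasurable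
    _ = _ := by
      congr 1 with φ
      refine setLIntegral_congr_fun measurableSet_Ioi fun ρ hρ => ?_
      have hρ : 0 < ρ := hρ
      rw [← lintegral_indicator measurableSet_Ioo, ← lintegral_indicator measurableSet_Ioo]
      congr 1 with θ
      by_cases h : θ ∈ Ioo 0 Real.pi
      · have hs := Real.sin_pos_of_mem_Ioo h
        rw [indicator_of_mem h, indicator_of_mem (show θ ∈ Ioo (-Real.pi) Real.pi from
          ⟨by linarith [h.1, Real.pi_pos], h.2⟩),
          indicator_of_mem (show ρ * Real.sin θ ∈ Ioi 0 from mul_pos hρ hs),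
          ← mul_assoc, ← ENNReal.ofReal_mul hρ.le]
        congr 2; ring
      · rw [indicator_of_notMem h]
        by_cases h' : θ ∈ Ioo (-Real.pi) Real.pi
        · have : θ ≤ 0 := by
            by_contra! h0
            exact h ⟨h0, h'.2⟩
          have : ¬ (0 < ρ * Real.sin θ) := by
            have := Real.sin_nonpos_of_nonpos_of_neg_pi_le this h'.1.le
            nlinarith
          rw [indicator_of_mem h', indicator_of_notMem (by exact this), mul_zero]
        · rw [indicator_of_notMem h']

lemma norm_cylPoint_sq (b : OrthonormalBasis (Fin 3) ℝ E3) (p : ℝ × (ℝ × ℝ)) :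
    ‖cylPoint b p‖ ^ 2 = p.2.1 ^ 2 + p.2.2 ^ 2 + p.1 ^ 2 := by
  rw [← b.sum_sq_norm_inner_right, Fin.sum_univ_three]
  simp [cylPoint, inner_add_right, inner_smul_right, b.inner_eq_ite]

/-- The point of the sphere with polar angle `θ` from `b₂` and azimuth `φ`. -/
noncomputable def sphPoint (b : OrthonormalBasis (Fin 3) ℝ E3) (p : ℝ × ℝ) : Sphere2 :=
  ⟨cylPoint b (Real.cos p.1, (Real.sin p.1 * Real.cos p.2, Real.sin p.1 * Real.sin p.2)), by
    rw [mem_sphere_zero_iff_norm, ← sq_eq_sq₀ (norm_nonneg _) zero_le_one, norm_cylPoint_sq]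
    linear_combination (Real.sin p.1 ^ 2) * Real.sin_sq_add_cos_sq p.2 + Real.sin_sq_add_cos_sq p.1⟩

lemma continuous_sphPoint (b : OrthonormalBasis (Fin 3) ℝ E3) : Continuous (sphPoint b) := by
  refine Continuous.subtype_mk ?_ _
  unfold cylPoint
  fun_prop

/-- The domain of the polar angle and the azimuth. -/
def sphDomain : Set (ℝ × ℝ) := Ioo 0 Real.pi ×ˢ Ioo (-Real.pi) Real.pi

lemma measurableSet_sphDomain : MeasurableSet sphDomain := measurableSet_Ioo.prod measurableSet_Ioo

lemma lintegral_Ioo_sq :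
    ∫⁻ ρ in Ioo (0 : ℝ) 1, ENNReal.ofReal (ρ ^ 2) = ENNReal.ofReal (1 / 3) := by
  rw [← ofReal_integral_eq_lintegral_ofReal, ← integral_Ioc_eq_integral_Ioo,
    ← intervalIntegral.integral_of_le zero_le_one]
  · norm_num
  · exact ((continuous_pow 2).integrableOn_Icc (a := (0 : ℝ)) (b := 1)).mono_set Ioo_subset_Icc_self
  · exact ae_of_all _ fun x => sq_nonneg x

open scoped Pointwise in
-- `toSphere` gives a set three times the volume of the cone over it. In spherical coordinates the
-- radial integral of ρ² over (0, 1) is 1/3, which cancels the 3.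
lemma surf_eq_map (b : OrthonormalBasis (Fin 3) ℝ E3) :
    surf = Measure.map (sphPoint b) ((volume.restrict sphDomain).withDensity
      fun p => ENNReal.ofReal (Real.sin p.1)) := by
  ext s hs
  have hms : Measurable (sphPoint b) := (continuous_sphPoint b).measurable
  rw [Measure.map_apply hms hs, withDensity_apply _ (hms hs), Measure.restrict_restrict (hms hs),
    surf, Measure.toSphere_apply' _ hs]
  set S : Set E3 := (↑) '' s with hS
  have hSm : MeasurableSet S :=
    (MeasurableEmbedding.subtype_coe Metric.isClosed_sphere.measurableSet).measurableSet_image.2 hs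
  set A : Set E3 := Ioo (0 : ℝ) 1 • S with hA
  have hA' : ∀ y, y ∈ A ↔ ‖y‖ ∈ Ioo (0 : ℝ) 1 ∧ ‖y‖⁻¹ • y ∈ S := by
    intro y
    constructor
    · rintro ⟨r, hr, m, ⟨m', hm', rfl⟩, rfl⟩
      have : ‖r • (m' : E3)‖ = r := by
        rw [norm_smul, norm_eq_of_mem_sphere, mul_one, Real.norm_of_nonneg hr.1.le]
      refine ⟨by simpa only [this] using hr, ?_⟩
      simp only [this, smul_smul, inv_mul_cancel₀ hr.1.ne', one_smul]
      exact mem_image_of_mem _ hm'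
    · rintro ⟨h1, h2⟩
      exact ⟨‖y‖, h1, _, h2, by simp [smul_smul, mul_inv_cancel₀ h1.1.ne']⟩
  have hAm : MeasurableSet A := by
    have : A = (fun y : E3 => ‖y‖) ⁻¹' Ioo 0 1 ∩ (fun y : E3 => ‖y‖⁻¹ • y) ⁻¹' S := by
      ext y; exact hA' y
    rw [this]
    exact (measurable_norm measurableSet_Ioo).inter
      ((by fun_prop : Measurable fun y : E3 => ‖y‖⁻¹ • y) hSm)
  have hpt : ∀ ρ : ℝ, 0 < ρ → ∀ θ φ : ℝ, A.indicator (1 : E3 → ENNReal)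
      (cylPoint b (ρ * Real.cos θ, (ρ * Real.sin θ * Real.cos φ, ρ * Real.sin θ * Real.sin φ))) =
      (Iio (1 : ℝ)).indicator 1 ρ * (sphPoint b ⁻¹' s).indicator 1 (θ, φ) := by
    intro ρ hρ θ φ
    have h1 : cylPoint b (ρ * Real.cos θ,
        (ρ * Real.sin θ * Real.cos φ, ρ * Real.sin θ * Real.sin φ))
        = ρ • (sphPoint b (θ, φ) : E3) := by
      simp only [sphPoint, cylPoint, smul_add, smul_smul, mul_assoc]
    have h2 : ‖ρ • (sphPoint b (θ, φ) : E3)‖ = ρ := by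
      rw [norm_smul, norm_eq_of_mem_sphere, mul_one, Real.norm_of_nonneg hρ.le]
    have h3 : ρ • (sphPoint b (θ, φ) : E3) ∈ A ↔ ρ < 1 ∧ sphPoint b (θ, φ) ∈ s := by
      rw [hA', h2, smul_smul, inv_mul_cancel₀ hρ.ne', one_smul, hS,
        Subtype.val_injective.mem_set_image]
      simp [hρ]
    rw [h1]
    by_cases h4 : ρ < 1 <;> by_cases h5 : sphPoint b (θ, φ) ∈ s <;>
      simp [indicator, h3, h4, h5]
  have hind : Measurable ((sphPoint b ⁻¹' s).indicator (1 : ℝ × ℝ → ENNReal)) :=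
    measurable_one.indicator (hms hs)
  have hvol : volume A = ENNReal.ofReal (1 / 3) *
      ∫⁻ φ in Ioo (-Real.pi) Real.pi, ∫⁻ θ in Ioo 0 Real.pi,
        ENNReal.ofReal (Real.sin θ) * (sphPoint b ⁻¹' s).indicator 1 (θ, φ) := by
    rw [← lintegral_indicator_one hAm, lintegral_spherical b (measurable_one.indicator hAm),
      ← lintegral_const_mul' _ _ ENNReal.ofReal_ne_top]
    congr 1 with φ
    rw [← lintegral_Ioo_sq, ← lintegral_mul_const _ (by fun_prop)]
    have : Ioo (0 : ℝ) 1 = Iio 1 ∩ Ioi 0 := by rw [inter_comm]; rfl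
    rw [this, ← Measure.restrict_restrict measurableSet_Iio,
      ← lintegral_indicator measurableSet_Iio]
    refine setLIntegral_congr_fun measurableSet_Ioi fun ρ hρ => ?_
    have hρ : 0 < ρ := hρ
    simp only [hpt ρ hρ]
    by_cases h : ρ < 1
    · simp only [indicator_of_mem (show ρ ∈ Iio 1 from h)]
      rw [← lintegral_const_mul' _ _ ENNReal.ofReal_ne_top]
      congr 1 with θ
      rw [ENNReal.ofReal_mul (sq_nonneg _)]
      simp [mul_assoc]
    · simp [indicator, h]
  have h3 : ((Module.finrank ℝ E3 : ℕ) : ENNReal) * ENNReal.ofReal (1 / 3) = 1 := by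
    rw [finrank_euclideanSpace_fin, ← ENNReal.ofReal_natCast, ← ENNReal.ofReal_mul (by positivity)]
    norm_num
  have h4 : (fun p : ℝ × ℝ => (sphPoint b ⁻¹' s).indicator
      (fun p => ENNReal.ofReal (Real.sin p.1)) p) = fun p =>
      ENNReal.ofReal (Real.sin p.1) * (sphPoint b ⁻¹' s).indicator 1 p := by
    funext p
    by_cases hp : p ∈ sphPoint b ⁻¹' s <;> simp [indicator, hp]
  rw [hvol, ← mul_assoc, h3, one_mul, ← Measure.restrict_restrict (hms hs),
    ← lintegral_indicator (hms hs), h4, sphDomain, Measure.volume_eq_prod, ← Measure.prod_restrict,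
    lintegral_prod_symm (fun p : ℝ × ℝ => ENNReal.ofReal (Real.sin p.1) *
      (sphPoint b ⁻¹' s).indicator 1 p) ((by fun_prop : Measurable fun p : ℝ × ℝ =>
      ENNReal.ofReal (Real.sin p.1)).mul hind).aemeasurable]

instance : IsFiniteMeasure surf := inferInstanceAs (IsFiniteMeasure (Measure.toSphere _))

instance : surf.IsOpenPosMeasure := inferInstanceAs (Measure.IsOpenPosMeasure (Measure.toSphere _))

lemma integrable_surf_of_continuous {f : Sphere2 → ℝ} (hf : Continuous f) : Integrable f surf :=
  hf.integrable_of_hasCompactSupport (HasCompactSupport.of_compactSpace f)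

lemma integral_surf (b : OrthonormalBasis (Fin 3) ℝ E3) {f : Sphere2 → ℝ} (hf : Measurable f) :
    ∫ m, f m ∂surf = ∫ p in sphDomain, Real.sin p.1 * f (sphPoint b p) := by
  rw [surf_eq_map b, integral_map (continuous_sphPoint b).aemeasurable hf.aestronglyMeasurable,
    integral_withDensity_eq_integral_toReal_smul (by fun_prop) (by simp)]
  refine setIntegral_congr_fun measurableSet_sphDomain fun p hp => ?_
  rw [ENNReal.toReal_ofReal (Real.sin_pos_of_mem_Ioo hp.1).le, smul_eq_mul]

/-- Integration over the sphere of a function which separates in spherical coordinates. -/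
lemma integral_surf_of_eq_mul (b : OrthonormalBasis (Fin 3) ℝ E3) {f : Sphere2 → ℝ}
    (hf : Measurable f) {A T : ℝ → ℝ}
    (h : ∀ p ∈ sphDomain, f (sphPoint b p) = A p.1 * T p.2) :
    ∫ m, f m ∂surf =
      (∫ θ in 0..Real.pi, A θ * Real.sin θ) * ∫ φ in (-Real.pi)..Real.pi, T φ := by
  rw [integral_surf b hf, intervalIntegral.integral_of_le Real.pi_pos.le,
    intervalIntegral.integral_of_le (by linarith [Real.pi_pos]), integral_Ioc_eq_integral_Ioo,
    integral_Ioc_eq_integral_Ioo, ← setIntegral_prod_mul]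
  refine setIntegral_congr_fun measurableSet_sphDomain fun p hp => ?_
  simp only [h p hp]
  ring

lemma exists_orthonormalBasis_two_eq (n : Sphere2) :
    ∃ b : OrthonormalBasis (Fin 3) ℝ E3, b 2 = n := by
  have hv : Orthonormal ℝ (({2} : Set (Fin 3)).domRestrict fun _ => (n : E3)) := by
    constructor
    · intro i
      simp
    · intro i j hij
      exact absurd (Subsingleton.elim i j) hij
  obtain ⟨b, hb⟩ := hv.exists_orthonormalBasis_extension_of_card_eq (by simp)
  exact ⟨b, hb 2 rfl⟩

lemma inner_cylPoint (b : OrthonormalBasis (Fin 3) ℝ E3) (p q : ℝ × (ℝ × ℝ)) :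
    inner ℝ (cylPoint b p) (cylPoint b q) = p.2.1 * q.2.1 + p.2.2 * q.2.2 + p.1 * q.1 := by
  simp [cylPoint, inner_add_right, inner_add_left, inner_smul_right, inner_smul_left,
    b.inner_eq_ite]
  ring

lemma dotS_sphPoint (b : OrthonormalBasis (Fin 3) ℝ E3) {n : Sphere2} (hb : b 2 = n) (p : ℝ × ℝ) :
    dotS (sphPoint b p) n = Real.cos p.1 := by
  have := inner_cylPoint b
    (Real.cos p.1, (Real.sin p.1 * Real.cos p.2, Real.sin p.1 * Real.sin p.2)) (1, 0, 0)
  simpa [cylPoint, hb, dotS, sphPoint] using this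

lemma dotS_eq_cos (n m : Sphere2) : dotS m n = Real.cos (polarAngle n m) := by
  simp [dotS, polarAngle, InnerProductGeometry.cos_angle]

lemma polarAngle_mem (n m : Sphere2) : polarAngle n m ∈ Icc 0 Real.pi :=
  ⟨InnerProductGeometry.angle_nonneg _ _, InnerProductGeometry.angle_le_pi _ _⟩

lemma polarAngle_sphPoint (b : OrthonormalBasis (Fin 3) ℝ E3) {n : Sphere2} (hb : b 2 = n)
    {p : ℝ × ℝ} (hp : p.1 ∈ Icc 0 Real.pi) : polarAngle n (sphPoint b p) = p.1 := by
  refine Real.injOn_cos (polarAngle_mem _ _) hp ?_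
  exact (dotS_eq_cos _ _).symm.trans (dotS_sphPoint b hb p)

lemma exists_polarAngle_eq (n : Sphere2) {θ : ℝ} (hθ : θ ∈ Icc 0 Real.pi) :
    ∃ m, polarAngle n m = θ := by
  obtain ⟨b, hb⟩ := exists_orthonormalBasis_two_eq n
  exact ⟨_, polarAngle_sphPoint b hb (p := (θ, 0)) hθ⟩

lemma continuous_dotS (n : Sphere2) : Continuous fun m => dotS m n :=
  continuous_subtype_val.inner continuous_const

lemma continuous_polarAngle (n : Sphere2) : Continuous (polarAngle n) := by
  have h : polarAngle n = fun m => Real.arccos (dotS m n) := by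
    funext m
    rw [dotS_eq_cos, Real.arccos_cos (polarAngle_mem n m).1 (polarAngle_mem n m).2]
  rw [h]
  exact Real.continuous_arccos.comp (continuous_dotS n)

/-- Integration of a function of the polar angle. -/
lemma integral_surf_polarAngle (n : Sphere2) {f : ℝ → ℝ} (hf : Measurable f) :
    ∫ m, f (polarAngle n m) ∂surf = 2 * Real.pi * ∫ θ in 0..Real.pi, f θ * Real.sin θ := by
  obtain ⟨b, hb⟩ := exists_orthonormalBasis_two_eq n
  rw [integral_surf_of_eq_mul b (f := fun m => f (polarAngle n m))
    (hf.comp (continuous_polarAngle n).measurable) (A := f)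
    (T := fun _ => 1)]
  · simp
    ring
  · intro p hp
    rw [polarAngle_sphPoint b hb (Ioo_subset_Icc_self hp.1), mul_one]

/-! ### Moments of the axial weight in the polar angle. -/

/-- The moments `∫ cosᵏθ exp(η cos²θ) sin θ dθ` over `[0, π]`. -/
noncomputable def axialMoment (η : ℝ) (k : ℕ) : ℝ :=
  ∫ θ in 0..Real.pi, Real.cos θ ^ k * Real.exp (η * Real.cos θ ^ 2) * Real.sin θ

lemma axialMoment_def (η : ℝ) (k : ℕ) : axialMoment η k =
    ∫ θ in 0..Real.pi, Real.cos θ ^ k * Real.exp (η * Real.cos θ ^ 2) * Real.sin θ := rfl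

lemma integral_even_quartic (η c₀ c₂ c₄ : ℝ) :
    ∫ θ in 0..Real.pi, (c₀ + c₂ * Real.cos θ ^ 2 + c₄ * Real.cos θ ^ 4) *
      Real.exp (η * Real.cos θ ^ 2) * Real.sin θ =
    c₀ * axialMoment η 0 + c₂ * axialMoment η 2 + c₄ * axialMoment η 4 := by
  simp only [axialMoment, ← intervalIntegral.integral_const_mul]
  rw [← intervalIntegral.integral_add, ← intervalIntegral.integral_add]
  · congr 1 with θ
    ring
  all_goals
    apply Continuous.intervalIntegrable
    fun_prop

/-- Reduces every inequality between moments to a polynomial inequality on [−1, 1]. Zeros at 0 and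
±1 are allowed, as needed for x² − x⁴. -/
lemma integral_even_quartic_pos (η : ℝ) {c₀ c₂ c₄ : ℝ}
    (h : ∀ x ∈ Icc (-1 : ℝ) 1, 0 ≤ c₀ + c₂ * x ^ 2 + c₄ * x ^ 4)
    (h' : ∀ x ∈ Ioo (-1 : ℝ) 1, x ≠ 0 → 0 < c₀ + c₂ * x ^ 2 + c₄ * x ^ 4) :
    0 < c₀ * axialMoment η 0 + c₂ * axialMoment η 2 + c₄ * axialMoment η 4 := by
  have hpi := Real.pi_pos
  -- On the open interval (0, π/2) the cosine avoids 0 and ±1, so the integrand is strictly positive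
  -- there; nonnegativity suffices on the other half.
  rw [← integral_even_quartic, ← intervalIntegral.integral_add_adjacent_intervals
    (b := Real.pi / 2) (Continuous.intervalIntegrable (by fun_prop) _ _)
    (Continuous.intervalIntegrable (by fun_prop) _ _)]
  refine add_pos_of_pos_of_nonneg (intervalIntegral.intervalIntegral_pos_of_pos_on
    (Continuous.intervalIntegrable (by fun_prop) _ _) (fun θ hθ => ?_) (by positivity))
    (intervalIntegral.integral_nonneg (by linarith) fun θ hθ => ?_)
  · have hs : 0 < Real.sin θ := Real.sin_pos_of_mem_Ioo ⟨hθ.1, by linarith [hθ.2]⟩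
    have hc : 0 < Real.cos θ := Real.cos_pos_of_mem_Ioo ⟨by linarith [hθ.1], hθ.2⟩
    have := Real.sin_sq_add_cos_sq θ
    exact mul_pos (mul_pos (h' _ ⟨by linarith, by nlinarith⟩ hc.ne') (Real.exp_pos _)) hs
  · exact mul_nonneg (mul_nonneg (h _ (Real.cos_mem_Icc θ)) (Real.exp_pos _).le)
      (Real.sin_nonneg_of_mem_Icc ⟨by linarith [hθ.1], hθ.2⟩)

lemma axialMoment_zero_pos (η : ℝ) : 0 < axialMoment η 0 := by
  simpa using integral_even_quartic_pos η (c₀ := 1) (c₂ := 0) (c₄ := 0) (by simp) (by simp)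

lemma axialMoment_four_lt_two (η : ℝ) : axialMoment η 4 < axialMoment η 2 := by
  have := integral_even_quartic_pos η (c₀ := 0) (c₂ := 1) (c₄ := -1)
    (fun x hx => by
      nlinarith [mul_nonneg (sq_nonneg x) (by nlinarith [hx.1, hx.2] : 0 ≤ 1 - x ^ 2)])
    (fun x hx h0 => by
      have := mul_pos (pow_pos (abs_pos.2 h0) 2)
        (by rw [sq_abs]; nlinarith [hx.1, hx.2] : 0 < 1 - |x| ^ 2)
      rw [sq_abs] at this
      linarith)
  linarith

lemma axialMoment_two_lt_zero (η : ℝ) : axialMoment η 2 < axialMoment η 0 := by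
  have := integral_even_quartic_pos η (c₀ := 1) (c₂ := -1) (c₄ := 0)
    (fun x hx => by nlinarith [hx.1, hx.2]) (fun x hx _ => by nlinarith [hx.1, hx.2])
  linarith

/-- Integration by parts on the sphere. -/
lemma axialMoment_recursion (η : ℝ) :
    2 * η * (axialMoment η 2 - axialMoment η 4) = 3 * axialMoment η 2 - axialMoment η 0 := by
  -- In x = cos θ this primitive is x(1 − x²)exp(ηx²), which vanishes at both ends; the integral of
  -- its derivative is the recursion.
  have h : ∀ θ ∈ uIcc 0 Real.pi, HasDerivAt
      (fun θ => Real.cos θ * Real.sin θ ^ 2 * Real.exp (η * Real.cos θ ^ 2))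
      ((-1 + (3 - 2 * η) * Real.cos θ ^ 2 + 2 * η * Real.cos θ ^ 4) *
        Real.exp (η * Real.cos θ ^ 2) * Real.sin θ) θ := by
    intro θ _
    have hc := Real.hasDerivAt_cos θ
    have hs := Real.hasDerivAt_sin θ
    refine ((hc.fun_mul (hs.fun_pow 2)).fun_mul (((hc.fun_pow 2).const_mul η).exp)).congr_deriv ?_
    have := Real.sin_sq θ
    push_cast
    linear_combination (Real.exp (η * Real.cos θ ^ 2) * Real.sin θ *
      (-1 - 2 * η * Real.cos θ ^ 2)) * this
  have := intervalIntegral.integral_eq_sub_of_hasDerivAt h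
    (Continuous.intervalIntegrable (by fun_prop) _ _)
  rw [integral_even_quartic] at this
  simp at this
  linarith

/-! ### Azimuthal integrals, and the second and fourth moments on the sphere. -/

lemma integral_cos_pow_mul_sin_pow_of_odd {i j : ℕ} (h : Odd i ∨ Odd j) :
    ∫ φ in (-Real.pi)..Real.pi, Real.cos φ ^ i * Real.sin φ ^ j = 0 := by
  rcases h with ⟨k, rfl⟩ | ⟨k, rfl⟩
  · simp_rw [mul_comm (Real.cos _ ^ _), integral_sin_pow_mul_cos_pow_odd]
    simp
  · simp_rw [mul_comm (Real.cos _ ^ _), integral_sin_pow_odd_mul_cos_pow]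
    simp

lemma integral_cos_sq_full : ∫ φ in (-Real.pi)..Real.pi, Real.cos φ ^ 2 = Real.pi := by
  rw [integral_cos_sq]; simp

lemma integral_sin_sq_full : ∫ φ in (-Real.pi)..Real.pi, Real.sin φ ^ 2 = Real.pi := by
  rw [integral_sin_sq]; simp

lemma integral_cos_pow_four_full :
    ∫ φ in (-Real.pi)..Real.pi, Real.cos φ ^ 4 = 3 * Real.pi / 4 := by
  rw [integral_cos_pow 2, integral_cos_sq_full]; simp; ring

lemma integral_sin_pow_four_full :
    ∫ φ in (-Real.pi)..Real.pi, Real.sin φ ^ 4 = 3 * Real.pi / 4 := by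
  rw [integral_sin_pow 2, integral_sin_sq_full]; simp; ring

lemma integral_cos_sq_mul_sin_sq_full :
    ∫ φ in (-Real.pi)..Real.pi, Real.cos φ ^ 2 * Real.sin φ ^ 2 = Real.pi / 4 := by
  simp_rw [mul_comm (Real.cos _ ^ _), integral_sin_sq_mul_cos_sq]
  have h : Real.sin (4 * Real.pi) = 0 := by simpa using Real.sin_nat_mul_pi 4
  simp [h]
  ring

/-- The unnormalized axially symmetric density `exp(η (m·n)²)`. -/
noncomputable def axialWeight (η : ℝ) (n m : Sphere2) : ℝ := Real.exp (η * dotS m n ^ 2)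

lemma continuous_axialWeight (η : ℝ) (n : Sphere2) : Continuous (axialWeight η n) :=
  Real.continuous_exp.comp (continuous_const.mul ((continuous_dotS n).pow 2))

/-- The `i`-th coordinate of a point of the sphere in an orthonormal basis. -/
noncomputable def coordS (b : OrthonormalBasis (Fin 3) ℝ E3) (i : Fin 3) (m : Sphere2) : ℝ :=
  inner ℝ (b i) (m : E3)

@[fun_prop]
lemma continuous_coordS (b : OrthonormalBasis (Fin 3) ℝ E3) (i : Fin 3) : Continuous (coordS b i) :=
  continuous_const.inner continuous_subtype_val

lemma coordS_sphPoint (b : OrthonormalBasis (Fin 3) ℝ E3) (p : ℝ × ℝ) :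
    coordS b 0 (sphPoint b p) = Real.sin p.1 * Real.cos p.2 ∧
    coordS b 1 (sphPoint b p) = Real.sin p.1 * Real.sin p.2 ∧
    coordS b 2 (sphPoint b p) = Real.cos p.1 := by
  simp [coordS, sphPoint, cylPoint, inner_add_right, inner_smul_right, b.inner_eq_ite]

lemma dotS_eq_coordS (b : OrthonormalBasis (Fin 3) ℝ E3) {n : Sphere2} (hb : b 2 = n)
    (m : Sphere2) : dotS m n = coordS b 2 m := by
  rw [dotS, coordS, hb, real_inner_comm]

lemma integral_monomial (b : OrthonormalBasis (Fin 3) ℝ E3) {n : Sphere2} (hb : b 2 = n)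
    (η : ℝ) (i j k : ℕ) :
    ∫ m, coordS b 0 m ^ i * coordS b 1 m ^ j * coordS b 2 m ^ k * axialWeight η n m ∂surf =
    (∫ θ in 0..Real.pi, Real.sin θ ^ (i + j) * Real.cos θ ^ k * Real.exp (η * Real.cos θ ^ 2) *
      Real.sin θ) * ∫ φ in (-Real.pi)..Real.pi, Real.cos φ ^ i * Real.sin φ ^ j := by
  have := continuous_axialWeight η n
  refine integral_surf_of_eq_mul b (Continuous.measurable (by fun_prop))
    (A := fun θ => Real.sin θ ^ (i + j) * Real.cos θ ^ k * Real.exp (η * Real.cos θ ^ 2))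
    (T := fun φ => Real.cos φ ^ i * Real.sin φ ^ j) fun p _ => ?_
  obtain ⟨h0, h1, h2⟩ := coordS_sphPoint b p
  rw [axialWeight, dotS_sphPoint b hb, h0, h1, h2]
  ring

lemma integral_monomial_of_odd (b : OrthonormalBasis (Fin 3) ℝ E3) {n : Sphere2}
    (hb : b 2 = n) (η : ℝ) {i j : ℕ} (k : ℕ) (h : Odd i ∨ Odd j) :
    ∫ m, coordS b 0 m ^ i * coordS b 1 m ^ j * coordS b 2 m ^ k * axialWeight η n m ∂surf = 0 := by
  rw [integral_monomial b hb, integral_cos_pow_mul_sin_pow_of_odd h, mul_zero]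

lemma integral_sin_sq_axial (η : ℝ) :
    ∫ θ in 0..Real.pi, Real.sin θ ^ 2 * Real.exp (η * Real.cos θ ^ 2) * Real.sin θ =
      axialMoment η 0 - axialMoment η 2 := by
  rw [show axialMoment η 0 - axialMoment η 2 =
    1 * axialMoment η 0 + -1 * axialMoment η 2 + 0 * axialMoment η 4 by ring,
    ← integral_even_quartic]
  congr 1 with θ
  rw [Real.sin_sq]
  ring

lemma integral_sin_pow_four_axial (η : ℝ) :
    ∫ θ in 0..Real.pi, Real.sin θ ^ 4 * Real.exp (η * Real.cos θ ^ 2) * Real.sin θ =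
      axialMoment η 0 - 2 * axialMoment η 2 + axialMoment η 4 := by
  rw [show axialMoment η 0 - 2 * axialMoment η 2 + axialMoment η 4 =
    1 * axialMoment η 0 + -2 * axialMoment η 2 + 1 * axialMoment η 4 by ring,
    ← integral_even_quartic]
  congr 1 with θ
  rw [show Real.sin θ ^ 4 = (Real.sin θ ^ 2) ^ 2 by ring, Real.sin_sq]
  ring

/-- The second moments of the axially symmetric weight. -/
lemma integral_coordS_mul_coordS (b : OrthonormalBasis (Fin 3) ℝ E3) {n : Sphere2} (hb : b 2 = n)
    (η : ℝ) (i j : Fin 3) :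
    ∫ m, coordS b i m * coordS b j m * axialWeight η n m ∂surf =
      if i = j then (if i = 2 then 2 * Real.pi * axialMoment η 2
        else Real.pi * (axialMoment η 0 - axialMoment η 2)) else 0 := by
  have h00 := integral_monomial b hb η 2 0 0
  have h11 := integral_monomial b hb η 0 2 0
  have h22 := integral_monomial b hb η 0 0 2
  have h01 := integral_monomial_of_odd b hb η (i := 1) (j := 1) 0 (by decide)
  have h02 := integral_monomial_of_odd b hb η (i := 1) (j := 0) 1 (by decide)
  have h12 := integral_monomial_of_odd b hb η (i := 0) (j := 1) 1 (by decide)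
  have comm : ∀ i j, ∫ m, coordS b i m * coordS b j m * axialWeight η n m ∂surf =
      ∫ m, coordS b j m * coordS b i m * axialWeight η n m ∂surf := fun i j => by
    congr 1 with m
    ring
  simp only [pow_one, pow_zero, mul_one, one_mul, zero_add, add_zero, integral_cos_sq_full,
    integral_sin_sq_full, integral_sin_sq_axial, ← axialMoment_def] at h00 h11 h22 h01 h02 h12
  simp only [pow_two (coordS _ _ _), mul_comm _ Real.pi] at h00 h11 h22
  fin_cases i <;> fin_cases j <;>
    simp [h00, h11, h22, h01, h02, h12, comm 1 0, comm 2 0, comm 2 1]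
  ring

/-- The function `m₀² - m₁²` on the sphere. -/
noncomputable def biaxial (b : OrthonormalBasis (Fin 3) ℝ E3) (m : Sphere2) : ℝ :=
  coordS b 0 m ^ 2 - coordS b 1 m ^ 2

@[fun_prop]
lemma continuous_biaxial (b : OrthonormalBasis (Fin 3) ℝ E3) : Continuous (biaxial b) := by
  unfold biaxial
  fun_prop

lemma integral_monomial_mul_biaxial (b : OrthonormalBasis (Fin 3) ℝ E3) (n : Sphere2)
    (η : ℝ) (i j k : ℕ) :
    ∫ m, coordS b 0 m ^ i * coordS b 1 m ^ j * coordS b 2 m ^ k *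
      (biaxial b m * axialWeight η n m) ∂surf =
    (∫ m, coordS b 0 m ^ (i + 2) * coordS b 1 m ^ j * coordS b 2 m ^ k * axialWeight η n m ∂surf) -
    ∫ m, coordS b 0 m ^ i * coordS b 1 m ^ (j + 2) * coordS b 2 m ^ k *
      axialWeight η n m ∂surf := by
  have := continuous_axialWeight η n
  rw [← integral_sub (integrable_surf_of_continuous (by fun_prop))
    (integrable_surf_of_continuous (by fun_prop))]
  congr 1 with m
  rw [biaxial]
  ring

lemma integral_monomial_mul_biaxial_of_odd (b : OrthonormalBasis (Fin 3) ℝ E3) {n : Sphere2}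
    (hb : b 2 = n) (η : ℝ) {i j : ℕ} (k : ℕ) (h : Odd i ∨ Odd j) :
    ∫ m, coordS b 0 m ^ i * coordS b 1 m ^ j * coordS b 2 m ^ k *
      (biaxial b m * axialWeight η n m) ∂surf = 0 := by
  rw [integral_monomial_mul_biaxial,
    integral_monomial_of_odd b hb η k (h.imp (fun h => h.add_even even_two) id),
    integral_monomial_of_odd b hb η k (h.imp id fun h => h.add_even even_two), sub_zero]

lemma integral_biaxial (b : OrthonormalBasis (Fin 3) ℝ E3) {n : Sphere2} (hb : b 2 = n)
    (η : ℝ) : ∫ m, biaxial b m * axialWeight η n m ∂surf = 0 := by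
  have h := integral_monomial_mul_biaxial b n η 0 0 0
  rw [integral_monomial b hb, integral_monomial b hb] at h
  simpa [integral_cos_sq_full, integral_sin_sq_full] using h

lemma integral_coordS_mul_coordS_mul_biaxial (b : OrthonormalBasis (Fin 3) ℝ E3) {n : Sphere2}
    (hb : b 2 = n) (η : ℝ) (i j : Fin 3) :
    ∫ m, coordS b i m * coordS b j m * (biaxial b m * axialWeight η n m) ∂surf =
      Real.pi / 2 * (axialMoment η 0 - 2 * axialMoment η 2 + axialMoment η 4) *
        if i = j then ![1, -1, 0] i else 0 := by
  have h00 := integral_monomial_mul_biaxial b n η 2 0 0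
  have h11 := integral_monomial_mul_biaxial b n η 0 2 0
  have h22 := integral_monomial_mul_biaxial b n η 0 0 2
  rw [integral_monomial b hb, integral_monomial b hb] at h00 h11 h22
  have h01 := integral_monomial_mul_biaxial_of_odd b hb η (i := 1) (j := 1) 0 (by decide)
  have h02 := integral_monomial_mul_biaxial_of_odd b hb η (i := 1) (j := 0) 1 (by decide)
  have h12 := integral_monomial_mul_biaxial_of_odd b hb η (i := 0) (j := 1) 1 (by decide)
  have comm : ∀ i j, ∫ m, coordS b i m * coordS b j m * (biaxial b m * axialWeight η n m) ∂surf =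
      ∫ m, coordS b j m * coordS b i m * (biaxial b m * axialWeight η n m) ∂surf := fun i j => by
    congr 1 with m
    ring
  simp only [pow_one, pow_zero, mul_one, one_mul, zero_add, add_zero, integral_cos_sq_full,
    integral_sin_sq_full, integral_sin_pow_four_axial, integral_cos_pow_four_full,
    integral_sin_pow_four_full, integral_cos_sq_mul_sin_sq_full, sub_self, Nat.reduceAdd]
    at h00 h11 h22 h01 h02 h12
  simp only [pow_two (coordS _ _ _)] at h00 h11 h22
  fin_cases i <;> fin_cases j <;>
    simp [h00, h11, h22, h01, h02, h12, comm 1 0, comm 2 0, comm 2 1] <;> ring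

lemma integral_biaxial_sq (b : OrthonormalBasis (Fin 3) ℝ E3) {n : Sphere2} (hb : b 2 = n)
    (η : ℝ) : ∫ m, biaxial b m ^ 2 * axialWeight η n m ∂surf =
    Real.pi * (axialMoment η 0 - 2 * axialMoment η 2 + axialMoment η 4) := by
  have := continuous_axialWeight η n
  have h0 := integral_coordS_mul_coordS_mul_biaxial b hb η 0 0
  have h1 := integral_coordS_mul_coordS_mul_biaxial b hb η 1 1
  have h : ∀ m, biaxial b m ^ 2 * axialWeight η n m =
      coordS b 0 m * coordS b 0 m * (biaxial b m * axialWeight η n m) -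
      coordS b 1 m * coordS b 1 m * (biaxial b m * axialWeight η n m) := fun m => by
    rw [biaxial]
    ring
  simp_rw [h]
  rw [integral_sub (integrable_surf_of_continuous (by fun_prop))
    (integrable_surf_of_continuous (by fun_prop)), h0, h1]
  simp
  ring

/-! ### The mean-field potential as a quadratic form in m. -/

lemma crossSq_eq (m m' : Sphere2) : crossSq m m' = 1 - dotS m m' ^ 2 := by
  have h : ∀ x y : Sphere2, (x : E3).ofLp ⬝ᵥ (y : E3).ofLp = dotS y x := fun x y => by
    simp [dotS, EuclideanSpace.inner_eq_star_dotProduct]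
  have h1 : ∀ x : Sphere2, dotS x x = 1 := fun x => by
    rw [dotS, real_inner_self_eq_norm_sq, norm_eq_of_mem_sphere, one_pow]
  rw [crossSq, cross_dot_cross, h, h, h, h, h1, h1, dotS, dotS, real_inner_comm]
  ring

lemma dotS_eq_sum (b : OrthonormalBasis (Fin 3) ℝ E3) (m m' : Sphere2) :
    dotS m m' = ∑ i, coordS b i m * coordS b i m' := by
  rw [dotS, ← b.sum_inner_mul_inner]
  simp only [coordS, real_inner_comm]

/-- The mean-field potential of a continuous density through its second moments. -/
lemma potential_eq (b : OrthonormalBasis (Fin 3) ℝ E3) (α : ℝ) {f : Sphere2 → ℝ}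
    (hf : Continuous f) (m : Sphere2) :
    potential α f m = α * (∫ m', f m' ∂surf - ∑ i, ∑ j, coordS b i m * coordS b j m *
      ∫ m', coordS b i m' * coordS b j m' * f m' ∂surf) := by
  have h : ∀ m', crossSq m m' * f m' = f m' - ∑ i, ∑ j, coordS b i m * coordS b j m *
      (coordS b i m' * coordS b j m' * f m') := fun m' => by
    rw [crossSq_eq, dotS_eq_sum b, pow_two, Finset.sum_mul_sum, sub_mul, one_mul, Finset.sum_mul]
    congr 1
    refine Finset.sum_congr rfl fun i _ => ?_
    rw [Finset.sum_mul]
    exact Finset.sum_congr rfl fun j _ => by ring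
  rw [potential]
  simp_rw [h]
  rw [integral_sub (integrable_surf_of_continuous hf)
    (integrable_surf_of_continuous (by fun_prop)), integral_finsetSum]
  · congr 3 with i
    rw [integral_finsetSum]
    · simp_rw [integral_const_mul]
    · exact fun j _ => integrable_surf_of_continuous (by fun_prop)
  · exact fun i _ => integrable_surf_of_continuous (by fun_prop)

/-! ### The kernel equation: weak form and Cauchy-Schwarz bound. -/

/-- A C¹ function on the closed interval is Lipschitz, so |g θ| ≤ K d with d the distance to the
nearer end point. Jordan's inequality sin θ ≥ 2d/π then bounds the quotient. -/
lemma exists_bound_div_sin {g : ℝ → ℝ} (hg : ContDiffOn ℝ 1 g (Icc 0 Real.pi)) (h0 : g 0 = 0)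
    (hπ : g Real.pi = 0) : ∃ C, ∀ θ ∈ Ioo 0 Real.pi, ‖g θ / Real.sin θ‖ ≤ C := by
  have hpi := Real.pi_pos
  have hc : ContinuousOn (derivWithin g (Icc 0 Real.pi)) (Icc 0 Real.pi) :=
    hg.continuousOn_derivWithin (uniqueDiffOn_Icc hpi) le_rfl
  obtain ⟨K, hK⟩ := isCompact_Icc.exists_bound_of_continuousOn hc
  have hd : DifferentiableOn ℝ g (Icc 0 Real.pi) := hg.differentiableOn one_ne_zero
  have lip : ∀ x ∈ Icc 0 Real.pi, ∀ y ∈ Icc 0 Real.pi, ‖g y - g x‖ ≤ K * ‖y - x‖ :=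
    fun x hx y hy => (convex_Icc 0 Real.pi).norm_image_sub_le_of_norm_derivWithin_le hd hK hx hy
  have hK0 : 0 ≤ K := (norm_nonneg _).trans (hK 0 ⟨le_rfl, hpi.le⟩)
  refine ⟨K * (Real.pi / 2), fun θ hθ => ?_⟩
  have hs := Real.sin_pos_of_mem_Ioo hθ
  rw [norm_div, Real.norm_of_nonneg hs.le, div_le_iff₀ hs]
  have key : ∀ d : ℝ, 2 / Real.pi * d ≤ Real.sin θ → ‖g θ‖ ≤ K * d →
      ‖g θ‖ ≤ K * (Real.pi / 2) * Real.sin θ := fun d h1 h2 => by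
    refine h2.trans ?_
    rw [mul_assoc]
    refine mul_le_mul_of_nonneg_left ?_ hK0
    calc d = Real.pi / 2 * (2 / Real.pi * d) := by field_simp
      _ ≤ _ := by gcongr
  rcases le_total θ (Real.pi / 2) with h | h
  · refine key θ (Real.mul_le_sin hθ.1.le h) ?_
    have := lip 0 ⟨le_rfl, hpi.le⟩ θ (Ioo_subset_Icc_self hθ)
    rwa [h0, sub_zero, sub_zero, Real.norm_of_nonneg hθ.1.le] at this
  · refine key (Real.pi - θ) ?_ ?_
    · rw [← Real.sin_pi_sub]
      exact Real.mul_le_sin (by linarith [hθ.2]) (by linarith)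
    · have := lip Real.pi ⟨hpi.le, le_rfl⟩ θ (Ioo_subset_Icc_self hθ)
      rwa [hπ, sub_zero, norm_sub_rev,
        Real.norm_of_nonneg (sub_nonneg.2 hθ.2.le)] at this

lemma intervalIntegrable_mul_div_sin {g F : ℝ → ℝ} (hg : ContDiffOn ℝ 1 g (Icc 0 Real.pi))
    (h0 : g 0 = 0) (hπ : g Real.pi = 0) (hF : ContinuousOn F (Icc 0 Real.pi)) :
    IntervalIntegrable (fun θ => F θ * (g θ / Real.sin θ)) volume 0 Real.pi := by
  obtain ⟨C, hC⟩ := exists_bound_div_sin hg h0 hπ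
  obtain ⟨K, hK⟩ := isCompact_Icc.exists_bound_of_continuousOn hF
  rw [intervalIntegrable_iff_integrableOn_Ioo_of_le Real.pi_pos.le]
  refine IntegrableOn.of_bound (by simp) (ContinuousOn.aestronglyMeasurable ?_ measurableSet_Ioo)
    (K * C) ?_
  · exact (hF.mono Ioo_subset_Icc_self).mul ((hg.continuousOn.mono Ioo_subset_Icc_self).div
      Real.continuous_sin.continuousOn fun θ hθ => (Real.sin_pos_of_mem_Ioo hθ).ne')
  · refine (ae_restrict_iff' measurableSet_Ioo).2 (ae_of_all _ fun θ hθ => ?_)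
    rw [norm_mul]
    exact mul_le_mul (hK θ (Ioo_subset_Icc_self hθ)) (hC θ hθ) (norm_nonneg _)
      ((norm_nonneg _).trans (hK θ (Ioo_subset_Icc_self hθ)))

section WeakForm

variable {u₀ g₀ : ℝ → ℝ} {η : ℝ}

/-- The weak form of the equation for the kernel profile. -/
lemma IsKernelProfile.weak_form (hg : IsKernelProfile u₀ g₀)
    (hu : ∀ θ ∈ Ioo 0 Real.pi, deriv u₀ θ = 2 * η * Real.sin θ * Real.cos θ)
    {w wd : ℝ → ℝ} (hw : ContinuousOn w (Icc 0 Real.pi)) (hwd : ContinuousOn wd (Icc 0 Real.pi))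
    (hd : ∀ θ ∈ Ioo 0 Real.pi, HasDerivAt w (wd θ) θ) :
    ∫ θ in 0..Real.pi, (Real.sin θ * Real.exp (η * Real.cos θ ^ 2) *
        derivWithin g₀ (Icc 0 Real.pi) θ * wd θ +
        Real.exp (η * Real.cos θ ^ 2) * w θ * (g₀ θ / Real.sin θ)) =
      ∫ θ in 0..Real.pi, w θ * (2 * η * Real.sin θ * Real.cos θ) *
        Real.exp (η * Real.cos θ ^ 2) * Real.sin θ := by
  have hpi := Real.pi_pos
  -- The one-sided derivative is continuous up to the end points and agrees with `deriv` inside.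
  set G := derivWithin g₀ (Icc 0 Real.pi) with hG
  have hGc : ContinuousOn G (Icc 0 Real.pi) :=
    hg.contDiffOn_Icc.continuousOn_derivWithin (uniqueDiffOn_Icc hpi) le_rfl
  have hGd : ∀ θ ∈ Ioo 0 Real.pi, G θ = deriv g₀ θ := fun θ hθ =>
    derivWithin_of_mem_nhds (Icc_mem_nhds hθ.1 hθ.2)
  have i1 : IntervalIntegrable (fun θ => Real.sin θ * Real.exp (η * Real.cos θ ^ 2) * G θ * wd θ)
      volume 0 Real.pi := by
    apply ContinuousOn.intervalIntegrable
    rw [uIcc_of_le hpi.le]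
    fun_prop
  have i2 := intervalIntegrable_mul_div_sin (F := fun θ => Real.exp (η * Real.cos θ ^ 2) * w θ)
    hg.contDiffOn_Icc hg.north hg.south (by fun_prop)
  have i3 : IntervalIntegrable (fun θ => w θ * (2 * η * Real.sin θ * Real.cos θ) *
        Real.exp (η * Real.cos θ ^ 2) * Real.sin θ) volume 0 Real.pi := by
    apply ContinuousOn.intervalIntegrable
    rw [uIcc_of_le hpi.le]
    fun_prop
  rw [← sub_eq_zero, ← intervalIntegral.integral_sub (i1.add i2) i3]
  -- The derivative of exp(η cos²θ) is −u₀' exp(η cos²θ), so this weight puts the equation in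
  -- divergence form. The boundary terms vanish with sin θ, whatever the end values of w.
  have ftc := intervalIntegral.integral_eq_sub_of_hasDerivAt_of_le hpi.le
    (f := fun θ => Real.sin θ * G θ * (Real.exp (η * Real.cos θ ^ 2) * w θ)) (by fun_prop) ?_
    ((i1.add i2).sub i3)
  · simpa using ftc
  · intro θ hθ
    have hs := (Real.sin_pos_of_mem_Ioo hθ).ne'
    have hode := hg.ode θ hθ
    have hdd : DifferentiableAt ℝ (deriv g₀) θ :=
      ((hg.contDiffOn_Ioo.deriv_of_isOpen isOpen_Ioo (m := 1) (by norm_num)).differentiableOn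
        one_ne_zero).differentiableAt (Ioo_mem_nhds hθ.1 hθ.2)
    have hD := ((Real.differentiableAt_sin (x := θ)).fun_mul hdd).hasDerivAt
    have hE : HasDerivAt (fun θ => Real.exp (η * Real.cos θ ^ 2))
        (Real.exp (η * Real.cos θ ^ 2) * (-(2 * η * Real.sin θ * Real.cos θ))) θ := by
      refine (((Real.hasDerivAt_cos θ).fun_pow 2).const_mul η).exp.congr_deriv ?_
      push_cast
      ring
    have hev : (fun θ => Real.sin θ * G θ * (Real.exp (η * Real.cos θ ^ 2) * w θ)) =ᶠ[𝓝 θ]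
        fun θ => Real.sin θ * deriv g₀ θ * (Real.exp (η * Real.cos θ ^ 2) * w θ) := by
      filter_upwards [Ioo_mem_nhds hθ.1 hθ.2] with s hs
      rw [hGd s hs]
    refine ((hD.fun_mul (hE.fun_mul (hd θ hθ))).congr_of_eventuallyEq hev).congr_deriv ?_
    rw [hGd θ hθ]
    rw [hu θ hθ] at hode
    have h1 : deriv (fun s => Real.sin s * deriv g₀ s) θ = Real.sin θ * (g₀ θ / Real.sin θ ^ 2 +
        2 * η * Real.sin θ * Real.cos θ * deriv g₀ θ - 2 * η * Real.sin θ * Real.cos θ) := by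
      field_simp at hode ⊢
      linear_combination hode
    rw [h1]
    field_simp
    ring

/-- Cauchy-Schwarz between g₀ and w = sin θ cos θ, a multiple of u₀' and the polar profile of the
quadratic function m₀m₂. The weak form tested with g₀ and with w supplies B(g₀, g₀) and B(g₀, w). -/
lemma IsKernelProfile.sq_le (hg : IsKernelProfile u₀ g₀)
    (hu : ∀ θ ∈ Ioo 0 Real.pi, deriv u₀ θ = 2 * η * Real.sin θ * Real.cos θ) :
    (3 * axialMoment η 2 - axialMoment η 0) ^ 2 ≤
      (axialMoment η 0 - 3 * axialMoment η 2 + 4 * axialMoment η 4) *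
      ∫ θ in 0..Real.pi, g₀ θ * (2 * η * Real.sin θ * Real.cos θ) *
        Real.exp (η * Real.cos θ ^ 2) * Real.sin θ := by
  have hpi := Real.pi_pos
  set E : ℝ → ℝ := fun θ => Real.exp (η * Real.cos θ ^ 2) with hE
  set G := derivWithin g₀ (Icc 0 Real.pi) with hG
  have hEc : Continuous E := by fun_prop
  have hgc : ContinuousOn g₀ (Icc 0 Real.pi) := hg.contDiffOn_Icc.continuousOn
  have hGc : ContinuousOn G (Icc 0 Real.pi) :=
    hg.contDiffOn_Icc.continuousOn_derivWithin (uniqueDiffOn_Icc hpi) le_rfl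
  have hgd : ∀ θ ∈ Ioo 0 Real.pi, HasDerivAt g₀ (G θ) θ := fun θ hθ => by
    have hm := Icc_mem_nhds hθ.1 hθ.2
    exact ((hg.contDiffOn_Icc.differentiableOn one_ne_zero) θ
      (Ioo_subset_Icc_self hθ)).hasDerivWithinAt.hasDerivAt hm
  set w : ℝ → ℝ := fun θ => Real.sin θ * Real.cos θ with hw
  set wd : ℝ → ℝ := fun θ => Real.cos θ ^ 2 - Real.sin θ ^ 2 with hwd
  have hwc : Continuous w := by fun_prop
  have hwdc : Continuous wd := by fun_prop
  have hB := hg.weak_form hu hgc hGc hgd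
  have hL := hg.weak_form hu (w := w) (wd := wd) hwc.continuousOn hwdc.continuousOn
    (fun θ _ => ((Real.hasDerivAt_sin θ).fun_mul (Real.hasDerivAt_cos θ)).congr_deriv
      (by simp only [hwd]; ring))
  have hL' : ∫ θ in 0..Real.pi, w θ * (2 * η * Real.sin θ * Real.cos θ) *
        Real.exp (η * Real.cos θ ^ 2) * Real.sin θ = 3 * axialMoment η 2 - axialMoment η 0 := by
    rw [← axialMoment_recursion, show 2 * η * (axialMoment η 2 - axialMoment η 4) =
      0 * axialMoment η 0 + 2 * η * axialMoment η 2 + -(2 * η) * axialMoment η 4 by ring,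
      ← integral_even_quartic]
    congr 1 with θ
    simp only [hw]
    linear_combination (2 * η * Real.cos θ ^ 2 * Real.exp (η * Real.cos θ ^ 2) * Real.sin θ) *
      Real.sin_sq θ
  -- This is B(w, w): the two terms are w'² and w²/sin²θ = cos²θ.
  have hA : ∫ θ in 0..Real.pi, (Real.sin θ * E θ * wd θ ^ 2 + Real.sin θ * E θ * Real.cos θ ^ 2) =
      axialMoment η 0 - 3 * axialMoment η 2 + 4 * axialMoment η 4 := by
    rw [show axialMoment η 0 - 3 * axialMoment η 2 + 4 * axialMoment η 4 =
      1 * axialMoment η 0 + -3 * axialMoment η 2 + 4 * axialMoment η 4 by ring,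
      ← integral_even_quartic]
    congr 1 with θ
    simp only [hwd, Real.sin_sq]
    ring
  rw [hL'] at hL
  have iB : IntervalIntegrable (fun θ => Real.sin θ * E θ * G θ * G θ +
      E θ * g₀ θ * (g₀ θ / Real.sin θ)) volume 0 Real.pi := by
    refine IntervalIntegrable.add (ContinuousOn.intervalIntegrable ?_)
      (intervalIntegrable_mul_div_sin hg.contDiffOn_Icc hg.north hg.south (by fun_prop))
    rw [uIcc_of_le hpi.le]
    fun_prop
  have iL : IntervalIntegrable (fun θ => Real.sin θ * E θ * G θ * wd θ +
      E θ * w θ * (g₀ θ / Real.sin θ)) volume 0 Real.pi := by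
    refine IntervalIntegrable.add (ContinuousOn.intervalIntegrable ?_)
      (intervalIntegrable_mul_div_sin hg.contDiffOn_Icc hg.north hg.south (by fun_prop))
    rw [uIcc_of_le hpi.le]
    fun_prop
  have iA : IntervalIntegrable (fun θ => Real.sin θ * E θ * wd θ ^ 2 +
      Real.sin θ * E θ * Real.cos θ ^ 2) volume 0 Real.pi :=
    Continuous.intervalIntegrable (by fun_prop) _ _
  -- The quadratic polynomial in t is B(g₀ − tw, g₀ − tw); its discriminant gives the claim.
  have key : ∀ t : ℝ, 0 ≤ (axialMoment η 0 - 3 * axialMoment η 2 + 4 * axialMoment η 4) * (t * t) +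
      (-2 * (3 * axialMoment η 2 - axialMoment η 0)) * t +
      ∫ θ in 0..Real.pi, g₀ θ * (2 * η * Real.sin θ * Real.cos θ) *
        Real.exp (η * Real.cos θ ^ 2) * Real.sin θ := by
    intro t
    rw [← hB, ← hL, ← hA, mul_comm _ (t * t), mul_right_comm (-2 : ℝ) _ t,
      ← intervalIntegral.integral_const_mul, ← intervalIntegral.integral_const_mul,
      ← intervalIntegral.integral_add (iA.const_mul _) (iL.const_mul _),
      ← intervalIntegral.integral_add ((iA.const_mul _).add (iL.const_mul _)) iB]
    refine intervalIntegral.integral_nonneg hpi.le fun θ hθ => ?_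
    have hEp : 0 < E θ := Real.exp_pos _
    -- Where sin θ = 0, every term has a factor sin θ or a division by it, which is 0 by convention.
    rcases (Real.sin_nonneg_of_mem_Icc hθ).eq_or_lt with hs | hs
    · simp [← hs]
    · have : 0 ≤ E θ * Real.sin θ * (G θ - t * wd θ) ^ 2 +
          E θ / Real.sin θ * (g₀ θ - t * w θ) ^ 2 := by
        positivity
      convert this using 1
      simp only [hw]
      field_simp
      ring
  have := discrim_le_zero key
  rw [discrim] at this
  linarith

end WeakForm

/-! ### Normalized averages and order parameters. -/

lemma axialWeight_eq (η : ℝ) (n m : Sphere2) :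
    axialWeight η n m = Real.exp (η * Real.cos (polarAngle n m) ^ 2) := by
  rw [axialWeight, dotS_eq_cos]

lemma integral_axialWeight (η : ℝ) (n : Sphere2) :
    ∫ m, axialWeight η n m ∂surf = 2 * Real.pi * axialMoment η 0 := by
  simp_rw [axialWeight_eq]
  rw [integral_surf_polarAngle n (f := fun θ => Real.exp (η * Real.cos θ ^ 2)) (by fun_prop)]
  simp [axialMoment]

lemma equilibrium_eq (η : ℝ) (n : Sphere2) :
    equilibrium η n = fun m => axialWeight η n m / (2 * Real.pi * axialMoment η 0) := by
  funext m
  rw [equilibrium, ← integral_axialWeight η n]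
  rfl

lemma avg_polarAngle (η : ℝ) (n : Sphere2) {f : ℝ → ℝ} (hf : Measurable f) :
    avg η n (fun m => f (polarAngle n m)) =
      (∫ θ in 0..Real.pi, f θ * Real.exp (η * Real.cos θ ^ 2) * Real.sin θ) / axialMoment η 0 := by
  have h0 := axialMoment_zero_pos η
  have hpi := Real.pi_pos
  simp_rw [avg, equilibrium_eq, axialWeight_eq, ← mul_div_assoc]
  rw [integral_div, integral_surf_polarAngle n
    (f := fun θ => f θ * Real.exp (η * Real.cos θ ^ 2)) (by fun_prop)]
  field_simp

/-- The moments `⟨(m·n)ᵏ⟩` of the axially symmetric density. -/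
noncomputable def meanPow (η : ℝ) (k : ℕ) : ℝ := axialMoment η k / axialMoment η 0

lemma avg_even_quartic (η : ℝ) (n : Sphere2) (c₀ c₂ c₄ : ℝ) :
    avg η n (fun m => c₀ + c₂ * dotS m n ^ 2 + c₄ * dotS m n ^ 4) =
      c₀ + c₂ * meanPow η 2 + c₄ * meanPow η 4 := by
  have h0 := axialMoment_zero_pos η
  simp_rw [dotS_eq_cos]
  rw [avg_polarAngle η n (f := fun θ => c₀ + c₂ * Real.cos θ ^ 2 + c₄ * Real.cos θ ^ 4)
    (by fun_prop), integral_even_quartic, meanPow, meanPow]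
  field_simp

lemma meanPow_two_lt_one (η : ℝ) : meanPow η 2 < 1 :=
  (div_lt_one (axialMoment_zero_pos η)).2 (axialMoment_two_lt_zero η)

lemma meanPow_four_lt_two (η : ℝ) : meanPow η 4 < meanPow η 2 :=
  div_lt_div_of_pos_right (axialMoment_four_lt_two η) (axialMoment_zero_pos η)

lemma meanPow_two_pos (η : ℝ) : 0 < meanPow η 2 := by
  have h := integral_even_quartic_pos η (c₀ := 0) (c₂ := 1) (c₄ := 0)
    (fun x _ => by nlinarith [sq_nonneg x]) (fun x _ h => by positivity)
  exact div_pos (by linarith) (axialMoment_zero_pos η)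

lemma meanPow_recursion (η : ℝ) :
    2 * η * (meanPow η 2 - meanPow η 4) = 3 * meanPow η 2 - 1 := by
  have h0 := (axialMoment_zero_pos η).ne'
  have := axialMoment_recursion η
  simp only [meanPow]
  field_simp
  linarith

lemma meanPow_biaxial_pos (η : ℝ) : 0 < 1 - 2 * meanPow η 2 + meanPow η 4 := by
  have h0 := axialMoment_zero_pos η
  have h := integral_even_quartic_pos η (c₀ := 1 / 2) (c₂ := -1) (c₄ := 1 / 2)
    (fun x _ => by nlinarith [sq_nonneg (1 - x ^ 2)]) (fun x hx _ => by
      nlinarith [pow_pos (by nlinarith [hx.1, hx.2] : 0 < 1 - x ^ 2) 2])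
  have := div_pos h h0
  simp only [meanPow]
  field_simp at this ⊢
  linarith

lemma legendreP_two_eval (x : ℝ) : (legendreP 2).eval x = -1 / 2 + 3 / 2 * x ^ 2 + 0 * x ^ 4 := by
  have h : ((Polynomial.X ^ 2 - 1) ^ 2 : Polynomial ℝ) =
      Polynomial.X ^ 4 - 2 * Polynomial.X ^ 2 + 1 := by ring
  rw [legendreP, h]
  simp only [Function.iterate_succ_apply, Function.iterate_zero_apply, Nat.factorial]
  simp
  ring

lemma legendreP_four_eval (x : ℝ) :
    (legendreP 4).eval x = 3 / 8 + -15 / 4 * x ^ 2 + 35 / 8 * x ^ 4 := by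
  have h : ((Polynomial.X ^ 2 - 1) ^ 4 : Polynomial ℝ) = Polynomial.X ^ 8 - 4 * Polynomial.X ^ 6 +
      6 * Polynomial.X ^ 4 - 4 * Polynomial.X ^ 2 + 1 := by ring
  rw [legendreP, h]
  simp only [Function.iterate_succ_apply, Function.iterate_zero_apply, Nat.factorial]
  simp
  ring

lemma orderParam_two (η : ℝ) (n : Sphere2) :
    orderParam 2 η n = (3 * meanPow η 2 - 1) / 2 := by
  simp_rw [orderParam, legendreP_two_eval]
  rw [avg_even_quartic]
  ring

lemma orderParam_four (η : ℝ) (n : Sphere2) :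
    orderParam 4 η n = (35 * meanPow η 4 - 30 * meanPow η 2 + 3) / 8 := by
  simp_rw [orderParam, legendreP_four_eval]
  rw [avg_even_quartic]
  ring

/-! ### Consequences of criticality and of stability. -/

lemma continuous_equilibrium (η : ℝ) (n : Sphere2) : Continuous (equilibrium η n) := by
  rw [equilibrium_eq]
  exact (continuous_axialWeight η n).div_const _

lemma sum_coordS_sq (b : OrthonormalBasis (Fin 3) ℝ E3) (m : Sphere2) :
    coordS b 0 m ^ 2 + coordS b 1 m ^ 2 + coordS b 2 m ^ 2 = 1 := by
  have h : dotS m m = 1 := by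
    rw [dotS, real_inner_self_eq_norm_sq, norm_eq_of_mem_sphere, one_pow]
  rw [dotS_eq_sum b, Fin.sum_univ_three] at h
  linarith

/-- Axial symmetry makes the second-moment tensor diagonal with two equal entries, and |m| = 1
eliminates the transverse coordinates. -/
lemma potential_equilibrium (α η : ℝ) (n m : Sphere2) :
    potential α (equilibrium η n) m =
      α * ((1 + meanPow η 2) / 2 - (3 * meanPow η 2 - 1) / 2 * dotS m n ^ 2) := by
  obtain ⟨b, hb⟩ := exists_orthonormalBasis_two_eq n
  have h0 := (axialMoment_zero_pos η).ne'
  have hpi := Real.pi_ne_zero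
  rw [potential_eq b α (continuous_equilibrium η n)]
  simp_rw [equilibrium_eq, ← mul_div_assoc, integral_div, integral_axialWeight,
    integral_coordS_mul_coordS b hb]
  rw [dotS_eq_coordS b hb]
  have h := sum_coordS_sq b m
  simp [Fin.sum_univ_three, meanPow]
  left
  field_simp
  linear_combination (axialMoment η 2 - axialMoment η 0) * h

/-- Up to a constant, ln h + 𝒰h is (η − αS₂)(m·n)². By continuity it is constant everywhere, and
comparing the pole with the equator kills the coefficient. -/
lemma IsCriticalPoint.eq_mul {α η : ℝ} {n : Sphere2} (h : IsCriticalPoint α (equilibrium η n)) :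
    η = α * ((3 * meanPow η 2 - 1) / 2) := by
  obtain ⟨-, -, c, hc⟩ := h
  have h0 := axialMoment_zero_pos η
  have hpi := Real.pi_pos
  have hform : ∀ m, Real.log (equilibrium η n m) + potential α (equilibrium η n) m =
      (η - α * ((3 * meanPow η 2 - 1) / 2)) * dotS m n ^ 2 +
      (α * ((1 + meanPow η 2) / 2) - Real.log (2 * Real.pi * axialMoment η 0)) := fun m => by
    rw [potential_equilibrium]
    simp only [equilibrium_eq, axialWeight]
    rw [Real.log_div (Real.exp_pos _).ne' (by positivity), Real.log_exp]
    ring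
  have hall : (fun m => (η - α * ((3 * meanPow η 2 - 1) / 2)) * dotS m n ^ 2 +
      (α * ((1 + meanPow η 2) / 2) - Real.log (2 * Real.pi * axialMoment η 0))) = fun _ => c := by
    have := continuous_dotS n
    refine Continuous.ae_eq_iff_eq surf (by fun_prop) continuous_const |>.1 ?_
    filter_upwards [hc] with m hm
    rw [← hm, hform]
  obtain ⟨m₁, h1⟩ := exists_polarAngle_eq n (θ := 0) ⟨le_rfl, hpi.le⟩
  obtain ⟨m₂, h2⟩ := exists_polarAngle_eq n (θ := Real.pi / 2) ⟨by positivity, by linarith⟩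
  have e1 := congrFun hall m₁
  have e2 := congrFun hall m₂
  simp only [dotS_eq_cos, h1, h2, Real.cos_zero, Real.cos_pi_div_two] at e1 e2
  linarith

/-- u₀ is prescribed only on [0, π], so its derivative is determined in the interior alone. -/
lemma IsPotentialProfile.deriv_eq {α η : ℝ} {n : Sphere2} {u₀ : ℝ → ℝ}
    (hu : IsPotentialProfile α η n u₀) (h : IsCriticalPoint α (equilibrium η n)) :
    ∀ θ ∈ Ioo 0 Real.pi, deriv u₀ θ = 2 * η * Real.sin θ * Real.cos θ := by
  intro θ hθ
  have hev : u₀ =ᶠ[𝓝 θ] fun s => α * ((1 + meanPow η 2) / 2) - η * Real.cos s ^ 2 := by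
    filter_upwards [Ioo_mem_nhds hθ.1 hθ.2] with s hs
    obtain ⟨m, hm⟩ := exists_polarAngle_eq n (Ioo_subset_Icc_self hs)
    have h1 := hu m
    rw [potential_equilibrium, dotS_eq_cos, hm] at h1
    rw [← h1]
    linear_combination (Real.cos s ^ 2) * h.eq_mul
  rw [hev.deriv_eq]
  refine (((((Real.hasDerivAt_cos θ).fun_pow 2).const_mul η).const_sub _).congr_deriv ?_).deriv
  push_cast
  ring

/-- The mean `⟨g₀ u₀'⟩` as an integral over the polar angle. -/
lemma avg_kernel_mul {η : ℝ} {n : Sphere2} {u₀ g₀ : ℝ → ℝ} (hg : IsKernelProfile u₀ g₀)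
    (hu : ∀ θ ∈ Ioo 0 Real.pi, deriv u₀ θ = 2 * η * Real.sin θ * Real.cos θ) :
    avg η n (fun m => g₀ (polarAngle n m) * deriv u₀ (polarAngle n m)) =
      (∫ θ in 0..Real.pi, g₀ θ * (2 * η * Real.sin θ * Real.cos θ) *
        Real.exp (η * Real.cos θ ^ 2) * Real.sin θ) / axialMoment η 0 := by
  -- g₀ is arbitrary outside [0, π]; truncation makes it measurable without changing its values at
  -- polar angles.
  have hm : Measurable ((Icc 0 Real.pi).indicator g₀) := by
    rw [← Set.piecewise_eq_indicator]
    exact hg.contDiffOn_Icc.continuousOn.measurable_piecewise continuousOn_const measurableSet_Icc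
  have h1 : ∀ m, g₀ (polarAngle n m) * deriv u₀ (polarAngle n m) =
      (Icc 0 Real.pi).indicator g₀ (polarAngle n m) * deriv u₀ (polarAngle n m) := fun m => by
    rw [indicator_of_mem (polarAngle_mem n m)]
  simp_rw [h1]
  rw [avg_polarAngle η n (f := fun θ => (Icc 0 Real.pi).indicator g₀ θ * deriv u₀ θ)
    (hm.mul (measurable_deriv u₀))]
  congr 1
  simp_rw [intervalIntegral.integral_of_le Real.pi_pos.le, integral_Ioc_eq_integral_Ioo]
  refine setIntegral_congr_fun measurableSet_Ioo fun θ hθ => ?_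
  simp only [indicator_of_mem (Ioo_subset_Icc_self hθ), hu θ hθ]

/-- Stability against the perturbation `(m₀² - m₁²) h`. -/
lemma IsStable.four_sub_nonneg {α η : ℝ} {n : Sphere2} (hs : IsStable α (equilibrium η n)) :
    0 ≤ 4 - α * (1 - 2 * meanPow η 2 + meanPow η 4) := by
  obtain ⟨b, hb⟩ := exists_orthonormalBasis_two_eq n
  have h0 := axialMoment_zero_pos η
  have hpi := Real.pi_pos
  set φ : Sphere2 → ℝ := fun m => biaxial b m * equilibrium η n m with hφ
  have hec := continuous_equilibrium η n
  have hφc : Continuous φ := by fun_prop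
  have hφe : ∀ m, φ m = biaxial b m * axialWeight η n m / (2 * Real.pi * axialMoment η 0) :=
    fun m => by
      simp only [hφ, equilibrium_eq]
      ring
  have hmean : ∫ m, φ m ∂surf = 0 := by
    simp_rw [hφe, integral_div, integral_biaxial b hb, zero_div]
  -- The second moments of φ are diagonal with entries q/4, −q/4, 0, where q = 1 − 2M₂ + M₄ =
  -- ⟨sin⁴θ⟩. So 𝒰φ is a multiple of m₀² − m₁², and the second variation becomes (1 − αq/4) times a
  -- positive integral.
  have hpot : ∀ m, potential α φ m =
      -(α * ((1 - 2 * meanPow η 2 + meanPow η 4) / 4)) * biaxial b m := fun m => by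
    rw [potential_eq b α hφc, hmean]
    simp_rw [hφe, ← mul_div_assoc, integral_div, integral_coordS_mul_coordS_mul_biaxial b hb]
    simp [Fin.sum_univ_three, meanPow, biaxial]
    field_simp
    ring
  have hmem : MemLp φ 2 surf := hφc.memLp_of_hasCompactSupport (HasCompactSupport.of_compactSpace φ)
  have key := hs φ hmem hmean
  have hint : ∀ m, (φ m / equilibrium η n m + potential α φ m) * φ m =
      (1 - α * ((1 - 2 * meanPow η 2 + meanPow η 4) / 4)) / (2 * Real.pi * axialMoment η 0) *
      (biaxial b m ^ 2 * axialWeight η n m) := fun m => by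
    have he : equilibrium η n m ≠ 0 := by
      rw [equilibrium_eq]
      exact (div_pos (Real.exp_pos _) (by positivity)).ne'
    rw [hpot, show φ m / equilibrium η n m = biaxial b m by simp only [hφ]; field_simp, hφe]
    ring
  simp_rw [hint, integral_const_mul, integral_biaxial_sq b hb] at key
  have hq := meanPow_biaxial_pos η
  have hM : 0 < axialMoment η 0 - 2 * axialMoment η 2 + axialMoment η 4 := by
    have := mul_pos hq h0
    simp only [meanPow] at this
    field_simp at this
    linarith
  by_contra! hlt
  refine absurd key (not_le.2 (mul_neg_of_neg_of_pos (div_neg_of_neg_of_pos ?_ ?_) ?_))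
  · linarith
  · positivity
  · positivity

/-! ### Block decomposition of the quadratic form. -/

section Form

variable {D : Matrix (Fin 3) (Fin 3) ℝ} {n : Fin 3 → ℝ}

lemma frob_vecMulVec : frob D (Matrix.vecMulVec n n) = n ⬝ᵥ (D *ᵥ n) := by
  simp [frob, Matrix.vecMulVec_apply, dotProduct, Matrix.mulVec, Fin.sum_univ_three]
  ring

/-- The Cauchy-Schwarz inequality `|D:nn| ≤ |D·n|`. -/
lemma frob_vecMulVec_sq_le (hn : n ⬝ᵥ n = 1) :
    frob D (Matrix.vecMulVec n n) ^ 2 ≤ (D *ᵥ n) ⬝ᵥ (D *ᵥ n) := by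
  rw [frob_vecMulVec]
  set v := D *ᵥ n
  have h : 0 ≤ (v - (n ⬝ᵥ v) • n) ⬝ᵥ (v - (n ⬝ᵥ v) • n) := by
    simp only [dotProduct]
    exact Finset.sum_nonneg fun i _ => mul_self_nonneg _
  simp only [sub_dotProduct, dotProduct_sub, smul_dotProduct, dotProduct_smul, hn, smul_eq_mul,
    dotProduct_comm v n] at h
  linarith

/-- The squared norm of the block of `D` orthogonal to `n` dominates that of its trace part. -/
lemma orthogonal_block_nonneg (hD : D.IsSymm) (hn : n ⬝ᵥ n = 1) (s : ℝ) :
    0 ≤ frob D D - 2 * ((D *ᵥ n) ⬝ᵥ (D *ᵥ n)) + frob D (Matrix.vecMulVec n n) ^ 2 -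
      2 * s * (D.trace - frob D (Matrix.vecMulVec n n)) + 2 * s ^ 2 := by
  rw [frob_vecMulVec]
  obtain ⟨v, hv⟩ : ∃ v, v = D *ᵥ n := ⟨_, rfl⟩
  obtain ⟨a, ha⟩ : ∃ a, a = n ⬝ᵥ v := ⟨_, rfl⟩
  rw [← hv, ← ha]
  -- The summands are the squared entries of PDP − sP, with P = 1 − n nᵀ the projection orthogonal
  -- to n.
  have h : 0 ≤ ∑ i, ∑ j, (D i j - n i * v j - v i * n j + a * n i * n j -
      s * ((if i = j then 1 else 0) - n i * n j)) ^ 2 := by positivity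
  convert h using 1
  have s01 : D 1 0 = D 0 1 := hD.apply 0 1
  have s02 : D 2 0 = D 0 2 := hD.apply 0 2
  have s12 : D 2 1 = D 1 2 := hD.apply 1 2
  have hX : v ⬝ᵥ (D *ᵥ n) = v ⬝ᵥ v := by rw [← hv]
  have hY : n ⬝ᵥ (D *ᵥ n) = a := by rw [← hv, ha]
  -- The expansion does not use |n| = 1 or the definitions of v and a, so that it is a polynomial
  -- identity in coordinates.
  have expand : ∑ i, ∑ j, (D i j - n i * v j - v i * n j + a * n i * n j -
      s * ((if i = j then 1 else 0) - n i * n j)) ^ 2 =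
      frob D D + 2 * (n ⬝ᵥ n) * (v ⬝ᵥ v) + 2 * (n ⬝ᵥ v) ^ 2 + a ^ 2 * (n ⬝ᵥ n) ^ 2 +
      s ^ 2 * (3 - 2 * (n ⬝ᵥ n) + (n ⬝ᵥ n) ^ 2) - 4 * (v ⬝ᵥ (D *ᵥ n)) + 2 * a * (n ⬝ᵥ (D *ᵥ n)) -
      2 * s * (D.trace - n ⬝ᵥ (D *ᵥ n)) - 4 * a * (n ⬝ᵥ n) * (n ⬝ᵥ v) +
      4 * s * (n ⬝ᵥ v - (n ⬝ᵥ n) * (n ⬝ᵥ v)) - 2 * a * s * ((n ⬝ᵥ n) - (n ⬝ᵥ n) ^ 2) := by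
    simp [frob, dotProduct, Matrix.mulVec, Fin.sum_univ_three, Matrix.trace, s01, s02, s12]
    ring
  rw [expand, hX, hY, hn, ← ha]
  ring

end Form

/-- Nonnegativity of the quadratic form from that of its three scalar blocks. -/
lemma leslieForm_nonneg {c : LeslieCoeffs} {D : Matrix (Fin 3) (Fin 3) ℝ} {n : Fin 3 → ℝ}
    (hD : D.IsSymm) (hn : n ⬝ᵥ n = 1) (h4 : 0 ≤ c.α₄)
    (hmix : 0 ≤ 2 * c.α₄ + c.α₅ + c.α₆ - c.γ₂ ^ 2 / c.γ₁)
    (h : 0 ≤ c.α₁ + c.α₄ + c.α₅ + c.α₆ ∨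
      D.trace = 0 ∧ 0 ≤ c.α₁ + 3 / 2 * c.α₄ + c.α₅ + c.α₆) :
    0 ≤ leslieForm c D n := by
  have hcs := frob_vecMulVec_sq_le (D := D) hn
  have hb := orthogonal_block_nonneg hD hn
  rw [leslieForm, sq_abs]
  set a := frob D (Matrix.vecMulVec n n)
  set d := (D *ᵥ n) ⬝ᵥ (D *ᵥ n)
  set F := frob D D
  have h1 := mul_nonneg hmix (sub_nonneg.2 hcs)
  rcases h with h | ⟨ht, h⟩
  · have h2 := mul_nonneg h4 (hb 0)
    have h3 := mul_nonneg h (sq_nonneg a)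
    linarith
  -- The 2×2 block has trace −a; removing its trace part, s = −a/2, shows that its squared norm is
  -- at least a²/2. This is the source of 3/2 in place of 1.
  · have h2 := mul_nonneg h4 (hb (-a / 2))
    rw [ht] at h2
    have h3 := mul_nonneg h (sq_nonneg a)
    linarith

lemma dotProduct_self_sphere (n : Sphere2) : (n : E3).ofLp ⬝ᵥ (n : E3).ofLp = 1 := by
  have h : inner ℝ (n : E3) (n : E3) = (1 : ℝ) := by
    rw [real_inner_self_eq_norm_sq, norm_eq_of_mem_sphere, one_pow]
  rwa [EuclideanSpace.inner_eq_star_dotProduct, star_trivial] at h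

/-! ### The Leslie coefficients and the dissipation. -/

section Main

variable {α η : ℝ} {n₀ : Sphere2} {u₀ g₀ : ℝ → ℝ}

/-- `γ₁` is half of the mean `⟨g₀ u₀'⟩`, and the Cauchy-Schwarz inequality for the Dirichlet form of
the kernel equation bounds it from below. -/
lemma leslie_γ₁_bounds (hη : η ≠ 0) (hcrit : IsCriticalPoint α (equilibrium η n₀))
    (hu : IsPotentialProfile α η n₀ u₀) (hg : IsKernelProfile u₀ g₀) :
    0 < (leslie η n₀ u₀ g₀).γ₁ ∧ (3 * meanPow η 2 - 1) ^ 2 ≤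
      (1 - 3 * meanPow η 2 + 4 * meanPow η 4) * (2 * (leslie η n₀ u₀ g₀).γ₁) := by
  have h0 := axialMoment_zero_pos η
  have hd := hu.deriv_eq hcrit
  -- Only this numerator of λ has to be nonzero: 1/λ = ⟨g₀u₀'⟩/(3M₂ − 1), and the order parameter S₂
  -- cancels it in γ₁.
  have hS : 3 * meanPow η 2 - 1 ≠ 0 := by
    rw [← meanPow_recursion]
    have := meanPow_four_lt_two η
    exact mul_ne_zero (by simpa using hη) (sub_ne_zero.2 this.ne')
  have hγ : 2 * (leslie η n₀ u₀ g₀).γ₁ =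
      (∫ θ in 0..Real.pi, g₀ θ * (2 * η * Real.sin θ * Real.cos θ) *
        Real.exp (η * Real.cos θ ^ 2) * Real.sin θ) / axialMoment η 0 := by
    have h3 : avg η n₀ (fun m => 3 * dotS m n₀ ^ 2 - 1) = 3 * meanPow η 2 - 1 := by
      have := avg_even_quartic η n₀ (-1) 3 0
      simp only [zero_mul, add_zero] at this
      rw [sub_eq_add_neg, add_comm, ← this]
      congr 1 with m
      ring
    rw [← avg_kernel_mul hg hd]
    simp only [LeslieCoeffs.γ₁, leslie, leslieOf, tumbling, h3, orderParam_two, one_div, inv_div]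
    field_simp
    ring
  have hle : (3 * meanPow η 2 - 1) ^ 2 ≤
      (1 - 3 * meanPow η 2 + 4 * meanPow η 4) * (2 * (leslie η n₀ u₀ g₀).γ₁) := by
    have h := hg.sq_le hd
    rw [hγ, meanPow, meanPow, show 3 * (axialMoment η 2 / axialMoment η 0) - 1 =
      (3 * axialMoment η 2 - axialMoment η 0) / axialMoment η 0 by field_simp,
      show 1 - 3 * (axialMoment η 2 / axialMoment η 0) + 4 * (axialMoment η 4 / axialMoment η 0) =
      (axialMoment η 0 - 3 * axialMoment η 2 + 4 * axialMoment η 4) / axialMoment η 0 by field_simp,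
      div_pow, div_mul_div_comm, ← pow_two]
    gcongr
  refine ⟨?_, hle⟩
  -- The polynomial is 1 − 3x² + 4x⁴ = (2x² − 1)² + x².
  have hA : 0 < 1 - 3 * meanPow η 2 + 4 * meanPow η 4 := by
    have h := integral_even_quartic_pos η (c₀ := 1) (c₂ := -3) (c₄ := 4)
      (fun x _ => by nlinarith [sq_nonneg (2 * x ^ 2 - 1), sq_nonneg x])
      (fun x _ hx => by nlinarith [sq_nonneg (2 * x ^ 2 - 1), pow_pos (abs_pos.2 hx) 2, sq_abs x])
    have := div_pos h h0
    simp only [meanPow]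
    field_simp at this ⊢
    linarith
  have := (mul_pos_iff_of_pos_left hA).1 (lt_of_lt_of_le (by positivity) hle)
  linarith

/-- The right side is 16(α₁ + α₄ + α₅ + α₆). For η > 0 it is (3M₂ − 1) + 17(M₂ − M₄) + 6M₂, all
positive. In the stable case it is (6M₂ − 5M₄ − 1) + 12(M₂ − M₄) + 8M₂, and stability makes the
first bracket nonnegative. -/
lemma meanPow_ineq (hη : η ≠ 0) (hcrit : IsCriticalPoint α (equilibrium η n₀))
    (h : IsStable α (equilibrium η n₀) ∨ 0 < η) :
    0 ≤ -1 + 26 * meanPow η 2 - 17 * meanPow η 4 := by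
  have h1 := meanPow_four_lt_two η
  have h2 := meanPow_two_pos η
  have h3 := meanPow_recursion η
  rcases h with h | h
  · have hs := h.four_sub_nonneg
    -- The recursion turns the critical relation into η = αη(M₂ − M₄). Multiplying the stability
    -- inequality by M₂ − M₄ then removes α.
    have hα : α * (meanPow η 2 - meanPow η 4) = 1 := by
      have hc := hcrit.eq_mul
      rw [← h3] at hc
      have : η * (α * (meanPow η 2 - meanPow η 4) - 1) = 0 := by linarith
      linarith [(mul_eq_zero.1 this).resolve_left hη]
    have := mul_nonneg hs (sub_pos.2 h1).le
    have h5 : 0 ≤ 4 * (meanPow η 2 - meanPow η 4) - (1 - 2 * meanPow η 2 + meanPow η 4) := by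
      linear_combination this - (1 - 2 * meanPow η 2 + meanPow η 4) * hα
    linarith
  · have := mul_pos h (sub_pos.2 h1)
    linarith

lemma leslieForm_leslie_nonneg (hη : η ≠ 0) (hcrit : IsCriticalPoint α (equilibrium η n₀))
    (hu : IsPotentialProfile α η n₀ u₀) (hg : IsKernelProfile u₀ g₀)
    {D : Matrix (Fin 3) (Fin 3) ℝ} (n : Sphere2) (hD : D.IsSymm)
    (h : IsStable α (equilibrium η n₀) ∨ 0 < η ∨ D.trace = 0) :
    0 ≤ leslieForm (leslie η n₀ u₀ g₀) D (n : E3).ofLp := by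
  obtain ⟨hγ, hle⟩ := leslie_γ₁_bounds hη hcrit hu hg
  have h1 := meanPow_four_lt_two η
  have h2 := meanPow_two_lt_one η
  have h3 := meanPow_two_pos η
  have hγ₂ : (leslie η n₀ u₀ g₀).γ₂ = -((3 * meanPow η 2 - 1) / 2) := by
    simp only [LeslieCoeffs.γ₂, leslie, leslieOf, orderParam_two]
    ring
  have e4 : (leslie η n₀ u₀ g₀).α₄ = (3 - 2 * meanPow η 2 - meanPow η 4) / 8 := by
    simp only [leslie, leslieOf, orderParam_two, orderParam_four]
    ring
  have e1 : (leslie η n₀ u₀ g₀).α₁ = -(35 * meanPow η 4 - 30 * meanPow η 2 + 3) / 16 := by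
    simp only [leslie, leslieOf, orderParam_four]
    ring
  have e56 : (leslie η n₀ u₀ g₀).α₅ + (leslie η n₀ u₀ g₀).α₆ =
      (35 * meanPow η 4 - 30 * meanPow η 2 + 3) / 28 + 5 * (3 * meanPow η 2 - 1) / 14 := by
    simp only [leslie, leslieOf, orderParam_two, orderParam_four]
    ring
  refine leslieForm_nonneg hD (dotProduct_self_sphere n) (by rw [e4]; linarith) ?_ ?_
  -- With this bound the mixed coefficient is at least M₂ − M₄.
  · have : (leslie η n₀ u₀ g₀).γ₂ ^ 2 / (leslie η n₀ u₀ g₀).γ₁ ≤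
        (1 - 3 * meanPow η 2 + 4 * meanPow η 4) / 2 := by
      rw [div_le_iff₀ hγ, hγ₂]
      linarith
    linarith
  · rw [← or_assoc] at h
    refine h.imp (fun h => ?_) fun h => ⟨h, ?_⟩
    · have := meanPow_ineq hη hcrit h
      linarith
    -- Here the coefficient is (1 + 12M₂ − 9M₄)/8, positive since M₄ < M₂.
    · linarith

end Main

lemma sum_mul_self_nonneg (v : Fin 3 → ℝ) : 0 ≤ v ⬝ᵥ v :=
  Finset.sum_nonneg fun i _ => mul_self_nonneg (v i)

lemma frob_self_nonneg (A : Matrix (Fin 3) (Fin 3) ℝ) : 0 ≤ frob A A :=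
  Finset.sum_nonneg fun i _ => Finset.sum_nonneg fun j _ => mul_self_nonneg (A i j)

lemma strain_isSymm (v : E3 → E3) (x : E3) : (strain v x).IsSymm := by
  simp [strain, Matrix.IsSymm, Matrix.transpose_add, add_comm]

lemma trace_strain {v : E3 → E3} {x : E3} (h : (grad v x).trace = 0) : (strain v x).trace = 0 := by
  simp [strain, h]

end DoiOnsager

open DoiOnsager
theorem theorem7p1 (α η : ℝ) (n₀ : Sphere2) (u₀ g₀ : ℝ → ℝ)
    (hη : η ≠ 0)
    (hcrit : IsCriticalPoint α (equilibrium η n₀))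
    (hu : IsPotentialProfile α η n₀ u₀)
    (hg : IsKernelProfile u₀ g₀) :
    0 < (leslie η n₀ u₀ g₀).γ₁ ∧
    (∀ (D : Matrix (Fin 3) (Fin 3) ℝ) (n : Sphere2), D.IsSymm →
      (IsStable α (equilibrium η n₀) ∨ 0 < η ∨ D.trace = 0) →
      0 ≤ leslieForm (leslie η n₀ u₀ g₀) D (n : E3).ofLp) ∧
    (∀ (γ k : ℝ) (Ω : Set E3) (v n : E3 → E3), 0 < γ → γ < 1 → IsOpen Ω →
      ContDiffOn ℝ 1 v Ω → ContDiffOn ℝ 2 n Ω →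
      (∀ x ∈ Ω, (grad v x).trace = 0) → (∀ x ∈ Ω, ‖n x‖ = 1) →
      IntegrableOn (dissipationDensity (leslie η n₀ u₀ g₀) γ k v n) Ω →
      0 ≤ ∫ x in Ω, dissipationDensity (leslie η n₀ u₀ g₀) γ k v n x) := by
  refine ⟨(leslie_γ₁_bounds hη hcrit hu hg).1,
    fun D n hD h => leslieForm_leslie_nonneg hη hcrit hu hg n hD h, ?_⟩
  intro γ k Ω v n hγ hγ1 hΩ _ _ hdiv hn _
  refine setIntegral_nonneg hΩ.measurableSet fun x hx => ?_
  have h1 := frob_self_nonneg (grad v x)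
  -- Incompressibility makes the strain trace-free, so neither stability nor the sign of η is
  -- needed.
  have h2 := leslieForm_leslie_nonneg hη hcrit hu hg ⟨n x, mem_sphere_zero_iff_norm.2 (hn x hx)⟩
    (strain_isSymm v x) (.inr (.inr (trace_strain (hdiv x hx))))
  have h3 := (leslie_γ₁_bounds hη hcrit hu hg).1
  have h4 := sum_mul_self_nonneg ((n x).ofLp ⨯₃ (k • Laplacian.laplacian n x).ofLp)
  have h5 : 0 < 1 - γ := sub_pos.2 hγ1
  unfold dissipationDensity
  positivity
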